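/- Let $V$ be a finite-dimensional real vector space with a Lorentzian form $\ell$ of signature $(+,-,\dots,-)$, let $C$ be one of the two closed cones forming $\{\ell(v,v)\ge 0\}$, and let $\Gamma$ be a group of affine transformations of $V$, acting freely and properly, whose linear parts preserve $\ell$ and $C$. Let $M=V/\Gamma$ with projection $\kappa:V\to M$ (a flat complete time-oriented Lorentzian manifold). $M$ is *causal* if no orbit $\Gamma v$ meets $v+C$ outside $v$ (no closed timelike paths), and *strictly causal* if, moreover, for each $p=\kappa(v)$ the past $\kappa(v-C)$ and the future $\kappa(v+C)$ are closed near $p$, i.e. relatively closed in some neighbourhood of $p$. $M$ is *unipotent* if it is strictly causal and its holonomy group (the group of linear parts of $\Gamma$) is unipotent. A *causal isometry* is an isometric diffeomorphism that preserves the orientation of timelike curves. A *realization* of $M$ consists of an origin $o\in V$ (used below to identify the affine space with the vector space $V$), vectors $v_0,v_1\in\partial C$ with $\ell(v_0,v_1)=1$, a linear subspace $T\subseteq N=v_0^\perp\cap v_1^\perp$, a linear mapping $a:T\to N$ with $\ell(ax,y)=\ell(x,ay)$ and $\ker(\mathbf 1+sa)=0$ for all $s\in\mathbb R$, and a linear isomorphism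 $\iota:\mathbb R^m\to T$, such that $\Gamma=\{\gamma_x: x\in\iota\,\mathbb Z^m\}$, where, with $l_0(v)=\ell(v_0,v)$, $$\gamma_x(v)=v+l_0(v)\,ax-\Big(\ell(ax,v)+\tfrac12 l_0(v)\ell(ax,ax)\Big)v_0+x-\tfrac12\ell(ax,x)v_0 .$$ In the elliptic case $a=0$, where $\gamma_x(v)=v+x$, the vectors $v_0,v_1$ are not needed and $T$ may be any linear subspace with $T\cap C=\{0\}$. The *signature* of the realization is $(n,m,r,k)$ with $n=\dim V$, $m=\dim T$, $r=\dim R$, $k=\dim\ker a$, where $R$ is the image of the component $a'':T\to T^\perp$ of $a=a'+a''$, $a':T\to T$. Its *characteristic polynomial* is $Q(s)=A+2sB+s^2C_2$ with the symmetric $m\times m$ matrices defined by $\langle Q(s)z,z\rangle=-\ell((\mathbf 1+sa)x,(\mathbf 1+sa)x)$, $x=\iota z$; equivalently $\langle Q(l_0(v))z,z\rangle=-\ell(\gamma_x(v)-v,\gamma_x(v)-v)$. **Theorem.** Let $M$ and $\tilde M$ be unipotent flat complete strictly causal Lorentzian manifolds. Then $M$ and $\tilde M$ have realizations, and for any choice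 of realizations, with characteristic polynomials $Q_M$ and $Q_{\tilde M}$, the manifolds $M$ and $\tilde M$ are causally isometric if and only if their signatures $(n,m,r,k)$ coincide and $$Q_M(s)=X^\top Q_{\tilde M}(\alpha s+\beta)X\qquad\text{for all } s\in\mathbb R$$ for some $X\in\mathrm{GL}(m,\mathbb Z)$, $\alpha>0$ and $\beta\in\mathbb R$. -/

import Mathlib

open scoped Topology ContDiff Matrix

noncomputable section

/-- A flat complete time-oriented Lorentzian manifold, presented as the quotient `M = V / Γ` of a
Minkowski space by a group of Poincare transformations acting freely and properly.
The norm of `V` only provides the (canonical) topology of this finite dimensional space. -/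
structure FlatSpacetime (V : Type*) [NormedAddCommGroup V] [NormedSpace ℝ V]
    [FiniteDimensional ℝ V] where
  /-- the Lorentzian form -/
  form : LinearMap.BilinForm ℝ V
  /-- the closed cone of future directed causal vectors -/
  cone : Set V
  form_symm : ∀ v w, form v w = form w v
  /-- `form` has signature `(+,-,...,-)` and `cone` is one of the two cones `form v v ≥ 0` -/
  lorentzian : ∃ e : V, 0 < form e e ∧ (∀ v, form e v = 0 → v ≠ 0 → form v v < 0) ∧
    cone = {v | 0 ≤ form v v ∧ 0 ≤ form e v}
  /-- the group of affine transformations (the fundamental group) -/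
  group : Subgroup (V ≃ᵃ[ℝ] V)
  form_linear : ∀ γ ∈ group, ∀ v w, form (γ.linear v) (γ.linear w) = form v w
  cone_linear : ∀ γ ∈ group, ∀ v ∈ cone, γ.linear v ∈ cone
  free : ∀ γ ∈ group, ∀ v, γ v = v → γ = 1
  proper : ∀ K : Set V, IsCompact K → {γ | γ ∈ group ∧ (γ '' K ∩ K).Nonempty}.Finite

namespace FlatSpacetime

variable {V : Type*} [NormedAddCommGroup V] [NormedSpace ℝ V] [FiniteDimensional ℝ V]
variable {V' : Type*} [NormedAddCommGroup V'] [NormedSpace ℝ V'] [FiniteDimensional ℝ V']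

/-- Two vectors are equivalent if they lie in one orbit of the group. -/
def orbitSetoid (M : FlatSpacetime V) : Setoid V where
  r v w := ∃ γ ∈ M.group, γ v = w
  iseqv :=
    { refl := fun v => ⟨1, M.group.one_mem, rfl⟩
      symm := by
        rintro v w ⟨γ, hγ, rfl⟩
        exact ⟨γ⁻¹, M.group.inv_mem hγ, γ.symm_apply_apply v⟩
      trans := by
        rintro u v w ⟨γ, hγ, rfl⟩ ⟨δ, hδ, rfl⟩
        exact ⟨δ * γ, M.group.mul_mem hδ hγ, rfl⟩ }

/-- The points of `M = V / Γ`, with the quotient topology. -/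
abbrev Point (M : FlatSpacetime V) : Type _ := Quotient M.orbitSetoid

/-- The quotient mapping `V → V / Γ`. -/
def proj (M : FlatSpacetime V) (v : V) : M.Point := Quotient.mk M.orbitSetoid v

/-- The future of `p` is the projection of `v + C`, where `v` lies over `p`. -/
def future (M : FlatSpacetime V) (p : M.Point) : Set M.Point :=
  {q | ∃ v, M.proj v = p ∧ ∃ c ∈ M.cone, M.proj (v + c) = q}

/-- The past of `p` is the projection of `v - C`, where `v` lies over `p`. -/
def past (M : FlatSpacetime V) (p : M.Point) : Set M.Point :=
  {q | ∃ v, M.proj v = p ∧ ∃ c ∈ M.cone, M.proj (v - c) = q}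

/-- `S` is closed near `p`: its trace on some open neighbourhood of `p` is relatively closed. -/
def ClosedNear {X : Type*} [TopologicalSpace X] (S : Set X) (p : X) : Prop :=
  ∃ U : Set X, IsOpen U ∧ p ∈ U ∧ ∃ F : Set X, IsClosed F ∧ S ∩ U = F ∩ U

/-- There are no closed timelike paths; for `V / Γ` this means that the orbit of a point `v` meets
the cone `v + C` only at `v`. -/
def IsCausal (M : FlatSpacetime V) : Prop :=
  ∀ γ ∈ M.group, ∀ v, γ v - v ∈ M.cone → γ = 1

/-- A causal manifold in which the past and the future of each point are closed near it. -/
def IsStrictlyCausal (M : FlatSpacetime V) : Prop :=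
  M.IsCausal ∧ ∀ p : M.Point, ClosedNear (M.past p) p ∧ ClosedNear (M.future p) p

/-- The holonomy group (the group of linear parts of `Γ`) is unipotent: in some linear basis it
consists of upper triangular matrices with unit diagonal. -/
def IsUnipotent (M : FlatSpacetime V) : Prop :=
  ∃ b : Module.Basis (Fin (Module.finrank ℝ V)) ℝ V, ∀ γ ∈ M.group,
    (∀ i j, j < i → LinearMap.toMatrix b b (γ.linear : V →ₗ[ℝ] V) i j = 0) ∧
    ∀ i, LinearMap.toMatrix b b (γ.linear : V →ₗ[ℝ] V) i i = 1

/-- `f` is smooth, its differentials preserve the Lorentzian metrics and send future directed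
causal vectors to future directed causal vectors. As the projections `V → M`, `V' → M'` are local
diffeomorphisms that define the metrics and the cones of `M` and `M'`, this is expressed by means
of local lifts `g` of `f`. -/
def IsLocalCausalIsometry (M : FlatSpacetime V) (M' : FlatSpacetime V')
    (f : M.Point → M'.Point) : Prop :=
  ∀ v : V, ∃ (U : Set V) (g : V → V'), IsOpen U ∧ v ∈ U ∧ ContDiffOn ℝ ∞ g U ∧
    (∀ u ∈ U, f (M.proj u) = M'.proj (g u)) ∧
    ∀ u ∈ U, (∀ x y, M'.form (fderiv ℝ g u x) (fderiv ℝ g u y) = M.form x y) ∧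
      ∀ x ∈ M.cone, fderiv ℝ g u x ∈ M'.cone

/-- There is a diffeomorphism of `M` onto `M'` that is an isometry of the Lorentzian metrics and
preserves the orientation of timelike curves. -/
def CausallyIsometric (M : FlatSpacetime V) (M' : FlatSpacetime V') : Prop :=
  ∃ f : M.Point ≃ₜ M'.Point, IsLocalCausalIsometry M M' f ∧ IsLocalCausalIsometry M' M f.symm

/-- The affine transformation `γ_x(v) = λ(x) v + τ(x)` of `V` with, for `l₀(v) = ℓ(v₀, v)`,
`λ(x) v = v + l₀(v) a x - (ℓ(a x, v) + l₀(v) ℓ(a x, a x) / 2) v₀`,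
`τ(x) = x - (ℓ(a x, x) / 2) v₀`. -/
def act (M : FlatSpacetime V) (v₀ : V) {T : Submodule ℝ V} (a : T →ₗ[ℝ] V) (x : T) (v : V) : V :=
  (v + M.form v₀ v • a x
      - (M.form (a x) v + 1 / 2 * M.form v₀ v * M.form (a x) (a x)) • v₀)
    + ((x : V) - (1 / 2 * M.form (a x) x) • v₀)

/-- The parameters `v₀`, `v₁`, `T`, `a` are as in the main construction: `v₀`, `v₁` are isotropic
vectors of the cone (that is, they belong to its boundary) with `ℓ(v₀, v₁) = 1`, and
`T` and the range of `a` lie in `N`, the orthogonal complement of `v₀` and `v₁`. -/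
def IsMainFrame (M : FlatSpacetime V) (v₀ v₁ : V) (T : Submodule ℝ V) (a : T →ₗ[ℝ] V) : Prop :=
  v₀ ∈ M.cone ∧ v₁ ∈ M.cone ∧ M.form v₀ v₀ = 0 ∧ M.form v₁ v₁ = 0 ∧ M.form v₀ v₁ = 1 ∧
  (∀ x : T, M.form v₀ x = 0 ∧ M.form v₁ x = 0) ∧
  ∀ x : T, M.form v₀ (a x) = 0 ∧ M.form v₁ (a x) = 0

/-- The elliptic type: `a = 0` and `T ∩ C = 0`. Then `γ_x` is the translation by `x` whatever
`v₀` and `v₁` are. -/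
def IsEllipticFrame (M : FlatSpacetime V) (T : Submodule ℝ V) (a : T →ₗ[ℝ] V) : Prop :=
  a = 0 ∧ ∀ x ∈ T, x ∈ M.cone → x = 0

/-- A realization of `M`: an origin `origin` in `V` and parameters `v₀, v₁, T, a` such that, in
the vector space `V` with this origin, the group of `M` consists of the transformations `γ_x`,
where `x` runs over the lattice in `T` generated by the basis `ι`. -/
structure Realization (M : FlatSpacetime V) where
  origin : V
  v₀ : V
  v₁ : V
  T : Submodule ℝ V
  a : T →ₗ[ℝ] V
  /-- the dimension of `T` -/
  m : ℕ
  /-- the isomorphism of `ℝ ^ m` onto `T` that maps `ℤ ^ m` onto the lattice -/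
  ι : Module.Basis (Fin m) ℝ T
  frame : M.IsMainFrame v₀ v₁ T a ∨ M.IsEllipticFrame T a
  a_symm : ∀ x y : T, M.form (a x) y = M.form x (a y)
  ker_eq_zero : ∀ (s : ℝ) (x : T), (x : V) + s • a x = 0 → x = 0
  mem_group : ∀ γ : V ≃ᵃ[ℝ] V, γ ∈ M.group ↔
    ∃ z : Fin m → ℤ, ∀ v, γ (origin + v) = origin + M.act v₀ a (∑ i, (z i : ℝ) • ι i) v

namespace Realization

variable {M : FlatSpacetime V}

/-- The image `R` of `a'' : T → T^⊥`, where `a = a' + a''` and `a' : T → T`; in other words, the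
set of all vectors orthogonal to `T` of the form `a x + t` with `x, t` in `T`. -/
def R (D : M.Realization) : Submodule ℝ V :=
  (LinearMap.range D.a ⊔ D.T) ⊓ M.form.orthogonal D.T

/-- The signature `(n, m, r, k)`: the dimensions of `M`, `T`, `R` and `ker a`. -/
def signature (D : M.Realization) : ℕ × ℕ × ℕ × ℕ :=
  (Module.finrank ℝ V, Module.finrank ℝ D.T, Module.finrank ℝ D.R,
    Module.finrank ℝ (LinearMap.ker D.a))

/-- `q_v(x) = - ℓ(γ_x(v) - v, γ_x(v) - v)`. -/
def q (D : M.Realization) (v : V) (x : D.T) : ℝ :=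
  - M.form (M.act D.v₀ D.a x v - v) (M.act D.v₀ D.a x v - v)

/-- The coefficient `A` of the characteristic polynomial. -/
def coeffA (D : M.Realization) : Matrix (Fin D.m) (Fin D.m) ℝ :=
  Matrix.of fun i j => - M.form (D.ι i) (D.ι j)

/-- The coefficient `B` of the characteristic polynomial. -/
def coeffB (D : M.Realization) : Matrix (Fin D.m) (Fin D.m) ℝ :=
  Matrix.of fun i j => - M.form (D.a (D.ι i)) (D.ι j)

/-- The coefficient `C` of the characteristic polynomial. -/
def coeffC (D : M.Realization) : Matrix (Fin D.m) (Fin D.m) ℝ :=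
  Matrix.of fun i j => - M.form (D.a (D.ι i)) (D.a (D.ι j))

/-- The characteristic matrix polynomial `Q_M(s) = A + 2 s B + s² C`. -/
def charPoly (D : M.Realization) (s : ℝ) : Matrix (Fin D.m) (Fin D.m) ℝ :=
  D.coeffA + (2 * s) • D.coeffB + s ^ 2 • D.coeffC

theorem q_eq_form (D : M.Realization) (v : V) (x : D.T) :
    D.q v x = - M.form x x - 2 * M.form D.v₀ v * M.form (D.a x) x
      - M.form D.v₀ v ^ 2 * M.form (D.a x) (D.a x) := by
  have e : M.act D.v₀ D.a x v - v = (x : V) + M.form D.v₀ v • D.a x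
      + (-(M.form (D.a x) v + 1 / 2 * M.form D.v₀ v * M.form (D.a x) (D.a x))
        - 1 / 2 * M.form (D.a x) x) • D.v₀ := by
    simp only [act]; module
  have hs := M.form_symm
  rcases D.frame with ⟨-, -, h0, -, -, hT, ha⟩ | ⟨h, -⟩
  · have h1 := (hT x).1
    have h2 := (ha x).1
    have h3 := hs x D.v₀
    have h4 := hs (D.a x) D.v₀
    have h5 := hs x (D.a x)
    simp only [q, e, map_add, map_smul, LinearMap.add_apply, LinearMap.smul_apply, smul_eq_mul,
      h0, h1, h2, h3, h4, h5]
    ring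
  · rw [q, e]
    simp [h]

/-- `q_v(x) = ⟨Q_M(s) z, z⟩`, where `s = l₀(v)` and `x = ι z`: the defining property of the
characteristic polynomial (its coefficients are symmetric by the symmetry of `ℓ` and `a`). -/
theorem q_eq_charPoly (D : M.Realization) (v : V) (z : Fin D.m → ℝ) :
    D.q v (∑ i, z i • D.ι i) = z ⬝ᵥ (D.charPoly (M.form D.v₀ v) *ᵥ z) := by
  rw [q_eq_form]
  simp only [charPoly, coeffA, coeffB, coeffC, dotProduct, Matrix.mulVec, Matrix.add_apply,
    Matrix.smul_apply, Matrix.of_apply, map_sum, map_smul, LinearMap.sum_apply,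
    LinearMap.smul_apply, smul_eq_mul, Submodule.coe_sum, Submodule.coe_smul, Finset.mul_sum]
  simp only [← Finset.sum_neg_distrib, ← Finset.sum_sub_distrib]
  rw [Finset.sum_comm]
  refine Finset.sum_congr rfl fun i _ => Finset.sum_congr rfl fun j _ => ?_
  ring

end Realization

end FlatSpacetime

end

noncomputable section

namespace FlatSpacetime

variable {V : Type*} [NormedAddCommGroup V] [NormedSpace ℝ V] [FiniteDimensional ℝ V]

/-! ### Lorentzian algebra -/

/-! Existence of realizations. A unipotent holonomy group is trivial or fixes an isotropic vector
`v₀`. In the second case unipotence puts every linear part into the abelian unipotent radical of the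
stabilizer of `v₀` (`IsUnipotent.linear_eq`), and causality makes `Γ` preserve the function `l₀`, so
that each element of `Γ` is given by a pair `(b, y)`. Such transformations compose as in a
Heisenberg group; their commutators are translations along `v₀`, which causality kills. Hence the
pairs form an additive group, discrete by properness. Strict causality enters through
`IsStrictlyCausal.not_recurrent`: large multiples of any vector of the real span are approximated by
elements of the lattice, so a one-parameter flow in the span that pushed a point along a causal
direction would bring its orbit back along a causal ray. Therefore `s b + y` is never a multiple of
`v₀` for a nonzero pair in the span (`IsStrictlyCausal.parameters_eq_zero`). This makes `b` a
function `a` of `y` and yields `ker (1 + s a) = 0`; the symmetry of `a` is the vanishing of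
commutators.

Classification. A causal isometry lifts to the covering space `V`, where a smooth isometry has
constant differential; so it amounts to an affine isometry `F` conjugating the groups. Such an `F`
preserves squares of displacements, and these are the values of `Q`: a linear isomorphism `E` of the
lattices makes `Q'` at `l₀'(F v)` correspond to `Q` at `l₀(v)`. As `Q` is not constant when `a ≠ 0`,
`l₀' ∘ F` is then an increasing affine function `α l₀ + β`.

Conversely, comparing powers of `s` in the congruence shows that `x, a x, v₀, v₁` and `E x + β a' E
x, α a' E x, α⁻¹ v₀', α v₁'` have equal Gram forms. By a Witt type extension
(`exists_isometry_of_gram`) some cone preserving isometry `L` carries the first system to the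
second, and `v ↦ L v + β v₁'` conjugates the groups. When `a = 0`, a timelike vector orthogonal to
`T` replaces `v₀, v₁`. Both directions pass through `Realization.IsEquivalence`, which also forces
`m, r, k` to agree once `n` does. -/

theorem form_neg_of_orthogonal (M : FlatSpacetime V) {u v : V} (hu : 0 < M.form u u)
    (huv : M.form u v = 0) (hv : v ≠ 0) : M.form v v < 0 := by
  obtain ⟨e, -, h, -⟩ := M.lorentzian
  by_contra! hvv
  have hs := M.form_symm
  have ha : M.form e u ≠ 0 := fun ha => by
    have hu0 : u ≠ 0 := by rintro rfl; simp at hu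
    exact absurd (h u ha hu0) (by linarith)
  -- This combination lies in `e^⊥`, where the form is negative definite, while its square is
  -- nonnegative under the contrary assumption.
  set w := M.form e v • u - M.form e u • v with hw
  have hew : M.form e w = 0 := by
    simp only [hw, map_sub, map_smul, smul_eq_mul]; ring
  have hww : M.form w w = M.form e v ^ 2 * M.form u u + M.form e u ^ 2 * M.form v v := by
    simp only [hw, map_sub, map_smul, LinearMap.sub_apply, LinearMap.smul_apply, smul_eq_mul,
      hs v u, huv]
    ring
  have hw0 : w = 0 := by
    by_contra hne
    have := h w hew hne
    have h1 : 0 ≤ M.form e v ^ 2 * M.form u u := by positivity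
    have h2 : 0 ≤ M.form e u ^ 2 * M.form v v := by positivity
    linarith
  have hb : M.form e v = 0 := by
    by_contra hb
    have h1 : 0 < M.form e v ^ 2 * M.form u u := by positivity
    have h2 : 0 ≤ M.form e u ^ 2 * M.form v v := by positivity
    rw [hw0] at hww
    simp only [map_zero] at hww
    linarith
  rw [hw, hb] at hw0
  simp only [zero_smul, zero_sub, neg_eq_zero, smul_eq_zero] at hw0
  tauto

theorem eq_zero_of_form_orthogonal (M : FlatSpacetime V) {u v : V} (hu : 0 < M.form u u)
    (huv : M.form u v = 0) (hv : 0 ≤ M.form v v) : v = 0 := by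
  by_contra h
  exact absurd (M.form_neg_of_orthogonal hu huv h) (by linarith)

theorem form_self_nonneg (M : FlatSpacetime V) {v : V} (hv : v ∈ M.cone) : 0 ≤ M.form v v := by
  obtain ⟨e, -, -, hC⟩ := M.lorentzian
  rw [hC] at hv
  exact hv.1

theorem zero_mem_cone (M : FlatSpacetime V) : (0 : V) ∈ M.cone := by
  obtain ⟨e, -, -, hC⟩ := M.lorentzian
  simp [hC]

theorem smul_mem_cone (M : FlatSpacetime V) {v : V} (hv : v ∈ M.cone) {c : ℝ} (hc : 0 ≤ c) :
    c • v ∈ M.cone := by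
  obtain ⟨e, -, -, hC⟩ := M.lorentzian
  rw [hC] at hv ⊢
  obtain ⟨h1, h2⟩ := hv
  simp only [Set.mem_ofPred_eq, map_smul, LinearMap.smul_apply, smul_eq_mul]
  constructor <;> positivity

theorem mem_cone_or_neg_mem (M : FlatSpacetime V) {v : V} (hv : 0 ≤ M.form v v) :
    v ∈ M.cone ∨ -v ∈ M.cone := by
  obtain ⟨e, -, -, hC⟩ := M.lorentzian
  rw [hC]
  simp only [Set.mem_ofPred_eq, map_neg, LinearMap.neg_apply, neg_neg, hv, true_and]
  rcases le_total 0 (M.form e v) with h | h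
  · exact Or.inl h
  · exact Or.inr (by linarith)

theorem eq_zero_of_mem_cone_of_neg_mem (M : FlatSpacetime V) {v : V} (hv : v ∈ M.cone)
    (hv' : -v ∈ M.cone) : v = 0 := by
  obtain ⟨e, he, -, hC⟩ := M.lorentzian
  rw [hC] at hv hv'
  refine M.eq_zero_of_form_orthogonal he (le_antisymm ?_ hv.2) hv.1
  have := hv'.2
  simp only [map_neg] at this
  linarith

/-- A negative product of `u` and `v` would give the combination `w` of them lying in `e^⊥` a
positive square. -/
theorem form_nonneg (M : FlatSpacetime V) {u v : V} (hu : u ∈ M.cone) (hv : v ∈ M.cone) :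
    0 ≤ M.form u v := by
  obtain ⟨e, he, h, hC⟩ := M.lorentzian
  rw [hC] at hu hv
  obtain ⟨hu1, hu2⟩ := hu
  obtain ⟨hv1, hv2⟩ := hv
  have hs := M.form_symm
  rcases hu2.eq_or_lt with ha | ha
  · rw [M.eq_zero_of_form_orthogonal he ha.symm hu1]; simp
  rcases hv2.eq_or_lt with hb | hb
  · rw [M.eq_zero_of_form_orthogonal he hb.symm hv1]; simp
  set w := M.form e v • u - M.form e u • v with hw
  have hew : M.form e w = 0 := by
    simp only [hw, map_sub, map_smul, smul_eq_mul]; ring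
  have hww : M.form w w = M.form e v ^ 2 * M.form u u
      - 2 * (M.form e u * M.form e v) * M.form u v + M.form e u ^ 2 * M.form v v := by
    simp only [hw, map_sub, map_smul, LinearMap.sub_apply, LinearMap.smul_apply, smul_eq_mul,
      hs v u]
    ring
  have hw0 : M.form w w ≤ 0 := by
    by_cases hne : w = 0
    · simp [hne]
    · exact (h w hew hne).le
  by_contra! hneg
  have h1 : 0 ≤ M.form e v ^ 2 * M.form u u := by positivity
  have h2 : 0 ≤ M.form e u ^ 2 * M.form v v := by positivity
  have h3 : 0 < M.form e u * M.form e v := by positivity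
  nlinarith [mul_pos h3 (neg_pos.2 hneg)]

theorem mem_cone_of_timelike (M : FlatSpacetime V) {u v : V} (hu : u ∈ M.cone)
    (huu : 0 < M.form u u) (hv : 0 ≤ M.form v v) (huv : 0 ≤ M.form u v) : v ∈ M.cone := by
  rcases M.mem_cone_or_neg_mem hv with h | h
  · exact h
  · have h1 := M.form_nonneg hu h
    rw [map_neg] at h1
    rw [M.eq_zero_of_form_orthogonal huu (by linarith) hv]
    exact M.zero_mem_cone

theorem add_mem_cone (M : FlatSpacetime V) {u v : V} (hu : u ∈ M.cone) (hv : v ∈ M.cone) :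
    u + v ∈ M.cone := by
  have h1 := M.form_self_nonneg hu
  have h2 := M.form_self_nonneg hv
  have h3 := M.form_nonneg hu hv
  obtain ⟨e, he, h, hC⟩ := M.lorentzian
  have h4 := M.form_symm v u
  rw [hC] at hu hv ⊢
  refine ⟨?_, ?_⟩
  · simp only [map_add, LinearMap.add_apply]; linarith
  · have := hu.2; have := hv.2; simp only [map_add]; linarith

theorem eq_zero_of_add_eq_zero_of_mem_cone (M : FlatSpacetime V) {u v : V} (hu : u ∈ M.cone)
    (hv : v ∈ M.cone) (h : u + v = 0) : u = 0 :=
  M.eq_zero_of_mem_cone_of_neg_mem hu (by rwa [neg_eq_of_add_eq_zero_right h])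

theorem eq_zero_of_form_eq_zero (M : FlatSpacetime V) {v : V} (h : ∀ w, M.form v w = 0) :
    v = 0 := by
  obtain ⟨e, he, -, -⟩ := M.lorentzian
  exact M.eq_zero_of_form_orthogonal he (by rw [M.form_symm]; exact h e) (h v).ge

theorem form_isRefl (M : FlatSpacetime V) : M.form.IsRefl := fun v w h => by
  rw [M.form_symm]; exact h

theorem form_nondegenerate (M : FlatSpacetime V) : M.form.Nondegenerate :=
  ⟨fun _ h => M.eq_zero_of_form_eq_zero h,
    fun _ h => M.eq_zero_of_form_eq_zero fun w => (M.form_symm _ _).trans (h w)⟩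

theorem form_continuous (M : FlatSpacetime V) {X : Type*} [TopologicalSpace X] {f g : X → V}
    (hf : Continuous f) (hg : Continuous g) : Continuous fun x => M.form (f x) (g x) := by
  have h1 : Continuous (fun v : V => LinearMap.toContinuousLinearMap (M.form v)) :=
    ((LinearMap.toContinuousLinearMap : (V →ₗ[ℝ] ℝ) ≃ₗ[ℝ] (V →L[ℝ] ℝ)).toLinearMap ∘ₗ
      M.form).continuous_of_finiteDimensional
  exact (h1.comp hf).clm_apply hg

/-! ### Isotropic vectors -/

/-- A combination of `v₀` and `y` lies in `e^⊥`, and its square is that of `y` up to a positive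
factor because `v₀` is orthogonal to `v₀` and `y`. So the form is negative semidefinite on `v₀^⊥`
with radical `ℝ v₀`. -/
theorem isotropic_perp (M : FlatSpacetime V) {v₀ y : V} (h0 : M.form v₀ v₀ = 0) (hne : v₀ ≠ 0)
    (hy : M.form v₀ y = 0) : M.form y y ≤ 0 ∧ (M.form y y = 0 → ∃ c : ℝ, y = c • v₀) := by
  obtain ⟨e, he, h, hC⟩ := M.lorentzian
  have hs := M.form_symm
  have ha : M.form e v₀ ≠ 0 := fun ha => hne (M.eq_zero_of_form_orthogonal he ha h0.ge)
  set w := M.form e y • v₀ - M.form e v₀ • y with hw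
  have hew : M.form e w = 0 := by
    simp only [hw, map_sub, map_smul, smul_eq_mul]; ring
  have hww : M.form w w = M.form e v₀ ^ 2 * M.form y y := by
    simp only [hw, map_sub, map_smul, LinearMap.sub_apply, LinearMap.smul_apply, smul_eq_mul,
      hs y v₀, hy, h0]
    ring
  have ha2 : 0 < M.form e v₀ ^ 2 := by positivity
  have hw0 : M.form w w ≤ 0 := by
    by_cases hne : w = 0
    · simp [hne]
    · exact (h w hew hne).le
  refine ⟨by nlinarith, fun hyy => ⟨M.form e y / M.form e v₀, ?_⟩⟩
  have : w = 0 := M.eq_zero_of_form_orthogonal he hew (by rw [hww, hyy, mul_zero])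
  have h2 : M.form e v₀ • y = M.form e y • v₀ := (sub_eq_zero.1 this).symm
  rw [div_eq_inv_mul, mul_smul, ← h2, smul_smul, inv_mul_cancel₀ ha, one_smul]

/-- An isotropic vector that has positive product with an isotropic vector of the cone. -/
theorem mem_cone_of_isotropic (M : FlatSpacetime V) {v₀ v₁ : V} (hv₀ : v₀ ∈ M.cone)
    (h1 : M.form v₁ v₁ = 0) (h : 0 < M.form v₀ v₁) : v₁ ∈ M.cone := by
  rcases M.mem_cone_or_neg_mem h1.ge with h' | h'
  · exact h'
  · have := M.form_nonneg hv₀ h'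
    rw [map_neg] at this
    linarith

/-- The vector `v₀ + v₁` has square 2, hence is timelike, and `y` is orthogonal to it. -/
theorem form_neg_of_perp (M : FlatSpacetime V) {v₀ v₁ y : V} (h0 : M.form v₀ v₀ = 0)
    (h1 : M.form v₁ v₁ = 0) (h : M.form v₀ v₁ = 1) (hy0 : M.form v₀ y = 0)
    (hy1 : M.form v₁ y = 0) (hy : y ≠ 0) : M.form y y < 0 := by
  refine M.form_neg_of_orthogonal (u := v₀ + v₁) ?_ (by simp [hy0, hy1]) hy
  simp only [map_add, LinearMap.add_apply, h0, h1, h, M.form_symm v₁ v₀]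
  norm_num

/-- A vector `e` with `ℓ(v₀, e) ≠ 0` yields a second isotropic vector, in the span of `v₀, e`. -/
theorem exists_isotropic (M : FlatSpacetime V) {v₀ e : V} (hv₀ : v₀ ∈ M.cone)
    (h0 : M.form v₀ v₀ = 0) (he : M.form v₀ e ≠ 0) :
    ∃ v₁ ∈ M.cone, M.form v₁ v₁ = 0 ∧ M.form v₀ v₁ = 1 ∧ ∃ c d : ℝ, v₁ = c • e + d • v₀ := by
  set α := M.form v₀ e with hα
  -- The factor of `e` normalizes the product with `v₀`; the multiple of `v₀` then cancels the
  -- square.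
  set v₁ := α⁻¹ • e + (-(α⁻¹) ^ 2 * M.form e e / 2) • v₀ with hv₁
  have h2 : M.form v₀ v₁ = 1 := by
    simp only [hv₁, map_add, map_smul, smul_eq_mul, h0, ← hα]
    field_simp
    simp
  have h1 : M.form v₁ v₁ = 0 := by
    simp only [hv₁, map_add, map_smul, LinearMap.add_apply, LinearMap.smul_apply, smul_eq_mul, h0,
      M.form_symm e v₀, ← hα]
    field_simp
    ring
  exact ⟨v₁, M.mem_cone_of_isotropic hv₀ h1 (by rw [h2]; norm_num), h1, h2, _, _, rfl⟩

end FlatSpacetime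

namespace FlatSpacetime

/-! ### Unipotent holonomy -/

/-- A linear transformation with upper unitriangular matrix shifts the flag of the basis. -/
theorem repr_sub_eq_zero_of_unitriangular {d : ℕ} {V : Type*} [AddCommGroup V] [Module ℝ V]
    (b : Module.Basis (Fin d) ℝ V) (g : V →ₗ[ℝ] V)
    (h0 : ∀ i j, j < i → LinearMap.toMatrix b b g i j = 0)
    (h1 : ∀ i, LinearMap.toMatrix b b g i i = 1) {k : ℕ} {v : V}
    (hv : ∀ i : Fin d, k + 1 ≤ (i : ℕ) → b.repr v i = 0) (i : Fin d) (hi : k ≤ (i : ℕ)) :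
    b.repr (g v - v) i = 0 := by
  have h := congrFun (LinearMap.toMatrix_mulVec_repr b b g v) i
  rw [map_sub, Finsupp.sub_apply, ← h, Matrix.mulVec, dotProduct, Finset.sum_eq_single i]
  · rw [h1, one_mul, sub_self]
  · intro j _ hj
    rcases lt_or_gt_of_ne hj with hj | hj
    · rw [h0 i j hj, zero_mul]
    · rw [hv j (by have : (i : ℕ) < j := hj; omega), mul_zero]
  · simp

variable {V : Type*} [NormedAddCommGroup V] [NormedSpace ℝ V] [FiniteDimensional ℝ V]

/-- Each application of `γ - 1` descends one level in the flag, so `dim V` applications suffice. -/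
theorem IsUnipotent.exists_pow_eq_zero {M : FlatSpacetime V} (hM : M.IsUnipotent)
    {γ : V ≃ᵃ[ℝ] V} (hγ : γ ∈ M.group) (v : V) :
    ∃ k, (fun w => γ.linear w - w)^[k] v = 0 := by
  obtain ⟨b, hb⟩ := hM
  obtain ⟨h0, h1⟩ := hb γ hγ
  refine ⟨Module.finrank ℝ V, ?_⟩
  suffices H : ∀ k l, k + l = Module.finrank ℝ V → ∀ i : Fin (Module.finrank ℝ V), l ≤ (i : ℕ) →
      b.repr ((fun w => γ.linear w - w)^[k] v) i = 0 by
    apply b.repr.injective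
    ext i
    rw [H _ 0 (by omega) i (by omega)]
    simp
  intro k
  induction k with
  | zero => intro l hl i hi; omega
  | succ k ih =>
    intro l hl i hi
    rw [Function.iterate_succ_apply']
    exact repr_sub_eq_zero_of_unitriangular b (γ.linear : V →ₗ[ℝ] V) h0 h1
      (ih (l + 1) (by omega)) i hi

/-- A nonzero vector of `U` at the lowest possible level of the flag is fixed: otherwise `γ u - u`
would be a nonzero vector of `U` at a lower level. -/
theorem IsUnipotent.exists_fixed {M : FlatSpacetime V} (hM : M.IsUnipotent)
    (U : Submodule ℝ V) (hU : U ≠ ⊥) (hinv : ∀ γ ∈ M.group, ∀ u ∈ U, γ.linear u ∈ U) :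
    ∃ u ∈ U, u ≠ 0 ∧ ∀ γ ∈ M.group, γ.linear u = u := by
  classical
  obtain ⟨b, hb⟩ := hM
  have hex : ∃ k : ℕ, ∃ u ∈ U, u ≠ 0 ∧
      ∀ i : Fin (Module.finrank ℝ V), k ≤ (i : ℕ) → b.repr u i = 0 := by
    obtain ⟨u, hu, hne⟩ := Submodule.exists_mem_ne_zero_of_ne_bot hU
    exact ⟨Module.finrank ℝ V, u, hu, hne, fun i hi => by omega⟩
  obtain ⟨u, hu, hne, h⟩ := Nat.find_spec hex
  refine ⟨u, hu, hne, fun γ hγ => ?_⟩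
  obtain ⟨h0, h1⟩ := hb γ hγ
  by_contra hfix
  cases hk : Nat.find hex with
  | zero =>
    rw [hk] at h
    exact hne (b.repr.injective (by ext i; simpa using h i (by omega)))
  | succ k =>
    rw [hk] at h
    exact Nat.find_min hex (m := k) (by omega) ⟨γ.linear u - u, U.sub_mem (hinv γ hγ u hu) hu,
      sub_ne_zero.2 hfix,
      repr_sub_eq_zero_of_unitriangular b (γ.linear : V →ₗ[ℝ] V) h0 h1 h⟩

/-- A unipotent holonomy group either is trivial or fixes an isotropic vector. -/
theorem IsUnipotent.trivial_or_isotropic {M : FlatSpacetime V} (hM : M.IsUnipotent) :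
    (∀ γ ∈ M.group, ∀ v, γ.linear v = v) ∨
    ∃ v₀ ∈ M.cone, v₀ ≠ 0 ∧ M.form v₀ v₀ = 0 ∧ ∀ γ ∈ M.group, γ.linear v₀ = v₀ := by
  by_contra! hcon
  obtain ⟨⟨γ₁, hγ₁, v₁, hv₁⟩, hiso⟩ := hcon
  have hiso' : ∀ v, v ≠ 0 → M.form v v = 0 → ∃ γ ∈ M.group, γ.linear v ≠ v := by
    intro v hv h0
    rcases M.mem_cone_or_neg_mem h0.ge with h | h
    · exact hiso v h hv h0
    · obtain ⟨γ, hγ, h2⟩ := hiso (-v) h (neg_ne_zero.2 hv) (by simpa using h0)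
      exact ⟨γ, hγ, fun h3 => h2 (by rw [map_neg, h3])⟩
  let F : Submodule ℝ V :=
    { carrier := {v | ∀ γ ∈ M.group, γ.linear v = v}
      add_mem' := fun {a b} ha hb γ hγ => by rw [map_add, ha γ hγ, hb γ hγ]
      zero_mem' := fun γ _ => map_zero _
      smul_mem' := fun c v hv γ hγ => by rw [map_smul, hv γ hγ] }
  -- The complement of `F` is invariant; a nonzero fixed vector in it would lie in both `F` and
  -- `F^⊥`, hence would be isotropic.
  have hperp : M.form.orthogonal F = ⊥ := by
    by_contra hne
    obtain ⟨u, hu, hu0, hfix⟩ := hM.exists_fixed (M.form.orthogonal F) hne (by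
      intro γ hγ u hu w hw
      have := M.form_linear γ hγ w u
      rw [hw γ hγ] at this
      exact this.trans (hu w hw))
    obtain ⟨γ, hγ, h⟩ := hiso' u hu0 (hu u hfix)
    exact h (hfix γ hγ)
  have htop : F = ⊤ := by
    rw [← M.form.orthogonal_orthogonal M.form_nondegenerate M.form_isRefl F, hperp]
    exact LinearMap.BilinForm.orthogonal_bot ..
  have : v₁ ∈ F := htop ▸ Submodule.mem_top
  exact hv₁ (this γ₁ hγ₁)

/-- The element of the unipotent radical of the stabilizer of `v₀` with parameter `b ⊥ v₀`. -/
def parabolic (M : FlatSpacetime V) (v₀ b v : V) : V :=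
  v + M.form v₀ v • b - (M.form b v + 1 / 2 * M.form v₀ v * M.form b b) • v₀

/-- On `v₀^⊥ / ℝ v₀` the form is definite, and a unipotent isometry of a definite form is the
identity. -/
theorem IsUnipotent.linear_sub_mem {M : FlatSpacetime V} (hM : M.IsUnipotent)
    {v₀ : V} (h0 : M.form v₀ v₀ = 0) (hne : v₀ ≠ 0)
    {γ : V ≃ᵃ[ℝ] V} (hγ : γ ∈ M.group) (hfix : γ.linear v₀ = v₀) {y : V} (hy : M.form v₀ y = 0) :
    ∃ c : ℝ, γ.linear y - y = c • v₀ := by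
  have hs := M.form_symm
  have hiso := M.form_linear γ hγ
  set n : V → V := fun w => γ.linear w - w with hn
  have hperp : ∀ w, M.form v₀ w = 0 → M.form v₀ (n w) = 0 := by
    intro w hw
    have := hiso v₀ w
    rw [hfix] at this
    simp only [hn, map_sub, this, hw, sub_self]
  -- Invariance of `ℓ(w, n w)` leaves `ℓ(n w, n w) = 0`, and isotropic vectors of `v₀^⊥` are
  -- multiples of `v₀`. This lowers the order of nilpotency one step at a time.
  have step : ∀ w, M.form v₀ w = 0 → (∃ c : ℝ, n (n w) = c • v₀) → ∃ c : ℝ, n w = c • v₀ := by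
    rintro w hw ⟨c, hc⟩
    refine (M.isotropic_perp h0 hne (hperp w hw)).2 ?_
    have e1 : γ.linear w = w + n w := by simp [hn]
    have e2 : γ.linear (n w) = n w + c • v₀ := by rw [← hc]; simp [hn]
    have h1 := hiso w w
    have h2 := hiso w (n w)
    rw [e2, e1] at h2
    have h3 := hs w v₀
    have h4 := hs (n w) v₀
    simp only [map_add, map_smul, LinearMap.add_apply, smul_eq_mul, h3, h4, hperp w hw, hw] at h2
    linarith
  obtain ⟨k, hk⟩ := hM.exists_pow_eq_zero hγ y
  have key : ∀ k, ∀ w, M.form v₀ w = 0 → n^[k] w = 0 → ∃ c : ℝ, n w = c • v₀ := by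
    intro k
    induction k with
    | zero =>
      intro w _ h
      rw [Function.iterate_zero_apply] at h
      exact ⟨0, by rw [h]; simp [hn]⟩
    | succ k ih =>
      intro w hw h
      exact step w hw (ih (n w) (hperp w hw) (by rwa [Function.iterate_succ_apply] at h))
  exact key k y hy hk

/-- The form of the linear parts of a unipotent holonomy group. -/
theorem IsUnipotent.linear_eq {M : FlatSpacetime V} (hM : M.IsUnipotent)
    {v₀ v₁ : V} (h0 : M.form v₀ v₀ = 0) (h1 : M.form v₁ v₁ = 0) (h01 : M.form v₀ v₁ = 1)
    {γ : V ≃ᵃ[ℝ] V} (hγ : γ ∈ M.group) (hfix : γ.linear v₀ = v₀) :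
    ∃ b, M.form v₀ b = 0 ∧ M.form v₁ b = 0 ∧ ∀ v, γ.linear v = M.parabolic v₀ b v := by
  have hs := M.form_symm
  have hiso := M.form_linear γ hγ
  have hne : v₀ ≠ 0 := by rintro rfl; simp at h01
  have h10 : M.form v₁ v₀ = 1 := by rw [hs, h01]
  have hp : M.form v₀ (γ.linear v₁ - v₁) = 0 := by
    have := hiso v₀ v₁
    rw [hfix] at this
    rw [map_sub, this, sub_self]
  set c := M.form v₁ (γ.linear v₁ - v₁) with hc
  set b := γ.linear v₁ - v₁ - c • v₀ with hb
  have hb0 : M.form v₀ b = 0 := by rw [hb, map_sub, hp, map_smul, h0]; simp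
  have hb1 : M.form v₁ b = 0 := by rw [hb, map_sub, ← hc, map_smul, h10]; simp
  have e1 : γ.linear v₁ = v₁ + b + c • v₀ := by rw [hb]; abel
  -- Invariance of `ℓ(v₁, v₁)` determines `c`; below, invariance of `ℓ(v₁, y)` determines `θ`.
  have hcb : 2 * c + M.form b b = 0 := by
    have := hiso v₁ v₁
    rw [e1] at this
    simp only [map_add, map_smul, LinearMap.add_apply, LinearMap.smul_apply, smul_eq_mul, h0, h1,
      h01, h10, hb0, hb1, hs b v₀, hs b v₁] at this
    linarith
  refine ⟨b, hb0, hb1, fun v => ?_⟩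
  set y := v - M.form v₀ v • v₁ - M.form v₁ v • v₀ with hy
  have hy0 : M.form v₀ y = 0 := by simp [hy, h0, h01]
  have hy1 : M.form v₁ y = 0 := by simp [hy, h1, h10]
  obtain ⟨θ, hθ⟩ := hM.linear_sub_mem h0 hne hγ hfix hy0
  have e2 : γ.linear y = y + θ • v₀ := by rw [← hθ]; abel
  have hθb : θ + M.form b y = 0 := by
    have := hiso v₁ y
    rw [e1, e2] at this
    simp only [map_add, map_smul, LinearMap.add_apply, LinearMap.smul_apply, smul_eq_mul, h0,
      h10, hb0, hy0, hy1, hs b v₀] at this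
    linarith
  have hv : v = M.form v₀ v • v₁ + M.form v₁ v • v₀ + y := by rw [hy]; abel
  have hbv : M.form b v = M.form b y := by
    conv_lhs => rw [hv]
    simp [hs b v₀, hs b v₁, hb0, hb1]
  have e3 : γ.linear v = M.form v₀ v • (v₁ + b + c • v₀) + M.form v₁ v • v₀ + (y + θ • v₀) := by
    conv_lhs => rw [hv]
    rw [map_add, map_add, map_smul, map_smul, e1, e2, hfix]
  rw [e3, parabolic, hbv, show M.form b b = -2 * c by linarith,
    show θ = -M.form b y by linarith, hy]
  module

end FlatSpacetime

/-! ### Lattices -/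

/-- Finiteness in the unit ball isolates 0, so `Λ` is a discrete subgroup, that is, a lattice in its
real span. -/
theorem AddSubgroup.exists_basis_of_finite_inter_ball {W : Type*} [NormedAddCommGroup W]
    [NormedSpace ℝ W] [FiniteDimensional ℝ W] (Λ : AddSubgroup W)
    (hfin : {x | x ∈ Λ ∧ ‖x‖ ≤ 1}.Finite) :
    ∃ (m : ℕ) (b : Module.Basis (Fin m) ℝ (Submodule.span ℝ (Λ : Set W))),
      ∀ x : W, x ∈ Λ ↔ ∃ z : Fin m → ℤ, x = ∑ i, (z i : ℝ) • (b i : W) := by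
  set S := Submodule.span ℝ (Λ : Set W) with hS
  set L : Submodule ℤ S := (AddSubgroup.toIntSubmodule Λ).comap (S.subtype.restrictScalars ℤ)
    with hL
  have hd : DiscreteTopology L := by
    refine discreteTopology_of_isOpen_singleton_zero ?_
    have hF : {x : L | ‖x‖ ≤ 1}.Finite := by
      refine Set.Finite.of_finite_image (f := fun x : L => ((x : S) : W)) (hfin.subset ?_) ?_
      · rintro _ ⟨x, hx, rfl⟩
        exact ⟨x.2, hx⟩
      · intro x _ y _ h
        exact Subtype.ext (Subtype.ext h)
    have : ({0} : Set L) = Metric.ball 0 1 ∩ ({x : L | ‖x‖ ≤ 1} \ {0})ᶜ := by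
      ext x
      simp only [Set.mem_singleton_iff, Set.mem_inter_iff, mem_ball_zero_iff, Set.mem_compl_iff,
        Set.mem_sdiff, Set.mem_ofPred_eq]
      constructor
      · rintro rfl; simp
      · rintro ⟨h1, h2⟩
        by_contra h
        exact h2 ⟨h1.le, h⟩
    rw [this]
    exact Metric.isOpen_ball.inter (hF.subset Set.sdiff_subset).isClosed.isOpen_compl
  have hZ : IsZLattice ℝ L := ⟨by
    rw [← (Submodule.map_injective_of_injective S.injective_subtype).eq_iff, Submodule.map_span,
      Submodule.map_top, Submodule.range_subtype]
    have : S.subtype '' (L : Set S) = Λ := by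
      ext x
      constructor
      · rintro ⟨y, hy, rfl⟩; exact hy
      · intro hx; exact ⟨⟨x, Submodule.subset_span hx⟩, hx, rfl⟩
    rw [this]⟩
  let b := Module.finBasis ℤ L
  refine ⟨_, b.ofZLatticeBasis ℝ L, fun x => ?_⟩
  have hsum : ∀ z : Fin (Module.finrank ℤ L) → ℤ,
      ∑ i, (z i : ℝ) • ((b.ofZLatticeBasis ℝ L i : S) : W) = ((∑ i, z i • b i : L) : S) := by
    intro z
    simp only [Module.Basis.ofZLatticeBasis_apply, Submodule.coe_sum, Submodule.coe_smul]
    exact Finset.sum_congr rfl fun i _ => Int.cast_smul_eq_zsmul ℝ _ _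
  constructor
  · intro hx
    refine ⟨fun i => b.repr ⟨⟨x, Submodule.subset_span hx⟩, hx⟩ i, ?_⟩
    rw [hsum, b.sum_repr]
  · rintro ⟨z, rfl⟩
    rw [hsum]
    exact (∑ i, z i • b i : L).2

/-- Dirichlet's argument: modulo the lattice the multiples `k ξ` stay in a bounded parallelepiped,
so two of them with widely separated indices are close to each other. -/
theorem AddSubgroup.exists_near_ray {W : Type*} [NormedAddCommGroup W]
    [NormedSpace ℝ W] [FiniteDimensional ℝ W] (Λ : AddSubgroup W) {m : ℕ}
    (b : Module.Basis (Fin m) ℝ (Submodule.span ℝ (Λ : Set W)))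
    (hb : ∀ x : W, x ∈ Λ ↔ ∃ z : Fin m → ℤ, x = ∑ i, (z i : ℝ) • (b i : W))
    {ξ : W} (hξ : ξ ∈ Submodule.span ℝ (Λ : Set W)) {ε : ℝ} (hε : 0 < ε) (T : ℝ) :
    ∃ x ∈ Λ, ∃ t ≥ T, ‖x - t • ξ‖ < ε := by
  set r : Fin m → ℝ := fun i => b.repr ⟨ξ, hξ⟩ i with hr
  have hξr : ξ = ∑ i, r i • (b i : W) := by
    have := congrArg Subtype.val (b.sum_repr ⟨ξ, hξ⟩)
    simpa only [Submodule.coe_sum, Submodule.coe_smul] using this.symm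
  set l : ℕ → W := fun k => ∑ i, ((⌊k * r i⌋ : ℤ) : ℝ) • (b i : W) with hl
  have hlΛ : ∀ k, l k ∈ Λ := fun k => (hb _).2 ⟨fun i => ⌊k * r i⌋, rfl⟩
  set x : ℕ → W := fun k => (k : ℝ) • ξ - l k with hx
  have hbd : ∀ k, x k ∈ Metric.closedBall (0 : W) (∑ i, ‖(b i : W)‖) := by
    intro k
    have : x k = ∑ i, Int.fract (k * r i) • (b i : W) := by
      simp only [hx, hl, hξr, Finset.smul_sum, ← Finset.sum_sub_distrib, smul_smul, ← sub_smul,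
        Int.self_sub_floor]
    rw [mem_closedBall_zero_iff, this]
    refine (norm_sum_le _ _).trans (Finset.sum_le_sum fun i _ => ?_)
    rw [norm_smul, Real.norm_of_nonneg (Int.fract_nonneg _)]
    exact mul_le_of_le_one_left (norm_nonneg _) (Int.fract_lt_one _).le
  obtain ⟨a, -, φ, hφ, hlim⟩ := tendsto_subseq_of_bounded Metric.isBounded_closedBall hbd
  obtain ⟨N, hN⟩ := Metric.cauchySeq_iff'.1 hlim.cauchySeq ε hε
  -- Since `φ k ≥ k`, an index at least `n` makes the difference of the two multipliers at least
  -- `T`.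
  obtain ⟨n, hn⟩ := exists_nat_ge (φ N + T)
  have h1 := hN (max n N) (le_max_right _ _)
  have h2 : (n : ℝ) ≤ φ (max n N) := by
    exact_mod_cast (le_max_left n N).trans (hφ.id_le _)
  refine ⟨l (φ (max n N)) - l (φ N), Λ.sub_mem (hlΛ _) (hlΛ _), φ (max n N) - φ N, by linarith, ?_⟩
  rw [dist_eq_norm, ← norm_neg] at h1
  refine lt_of_eq_of_lt (congrArg norm ?_) h1
  simp only [hx, Function.comp_apply]
  module

/-! ### Orbits in strictly causal manifolds -/

namespace FlatSpacetime

variable {V : Type*} [NormedAddCommGroup V] [NormedSpace ℝ V] [FiniteDimensional ℝ V]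

theorem proj_eq_iff (M : FlatSpacetime V) {v w : V} :
    M.proj v = M.proj w ↔ ∃ γ ∈ M.group, γ v = w := Quotient.eq

theorem continuous_proj (M : FlatSpacetime V) : Continuous M.proj := continuous_quotient_mk'

theorem proj_smul (M : FlatSpacetime V) {γ : V ≃ᵃ[ℝ] V} (hγ : γ ∈ M.group) (v : V) :
    M.proj (γ v) = M.proj v := (M.proj_eq_iff.2 ⟨γ, hγ, rfl⟩).symm

/-- In a strictly causal manifold no orbit comes back along a causal ray. -/
theorem IsStrictlyCausal.not_recurrent {M : FlatSpacetime V} (hM : M.IsStrictlyCausal) {v u : V}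
    (hu : u ∈ M.cone) (hne : u ≠ 0) :
    ¬ ∀ ε > (0 : ℝ), ∀ T : ℝ, ∃ γ ∈ M.group, ∃ t ≥ T, ‖γ v - t • u - v‖ < ε := by
  intro h
  obtain ⟨U, hU, hvU, F, hF, hUF⟩ := (hM.2 (M.proj v)).1
  have hU' : IsOpen (M.proj ⁻¹' U) := hU.preimage M.continuous_proj
  have hF' : IsClosed (M.proj ⁻¹' F) := hF.preimage M.continuous_proj
  obtain ⟨τ, hτ, hτU⟩ : ∃ τ > (0 : ℝ), v + τ • u ∈ M.proj ⁻¹' U := by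
    have hc : Filter.Tendsto (fun τ : ℝ => v + τ • u) (𝓝[>] 0) (𝓝 v) := by
      have : Continuous (fun τ : ℝ => v + τ • u) := by fun_prop
      have h0 := this.tendsto 0
      simp only [zero_smul, add_zero] at h0
      exact h0.mono_left nhdsWithin_le_nhds
    obtain ⟨τ, h1, h2⟩ := ((hc.eventually (hU'.mem_nhds hvU)).and self_mem_nhdsWithin).exists
    exact ⟨τ, h2, h1⟩
  -- The points `γ v - (t - τ) u` project to the past of `p` and come arbitrarily close to `v + τ
  -- u`, so local closedness puts the latter point over the past.
  have hmem : v + τ • u ∈ M.proj ⁻¹' F := by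
    rw [← hF'.closure_eq, Metric.mem_closure_iff]
    intro ε hε
    obtain ⟨δ, hδ, hball⟩ := Metric.isOpen_iff.1 hU' _ hτU
    obtain ⟨γ, hγ, t, ht, hlt⟩ := h (min ε δ) (lt_min hε hδ) τ
    have hd : dist (γ v - t • u + τ • u) (v + τ • u) < min ε δ := by
      rw [dist_eq_norm]
      rwa [show γ v - t • u + τ • u - (v + τ • u) = γ v - t • u - v by abel]
    refine ⟨γ v - t • u + τ • u, ?_, by rw [dist_comm]; exact hd.trans_le (min_le_left _ _)⟩
    have hwU : γ v - t • u + τ • u ∈ M.proj ⁻¹' U := hball (hd.trans_le (min_le_right _ _))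
    have hp : M.proj (γ v - t • u + τ • u) ∈ M.past (M.proj v) := by
      refine ⟨γ v, M.proj_smul hγ v, (t - τ) • u, M.smul_mem_cone hu (by linarith), ?_⟩
      congr 1
      module
    exact ((Set.ext_iff.1 hUF _).1 ⟨hp, hwU⟩).1
  obtain ⟨⟨v', hv', c, hc, hvc⟩, -⟩ := (Set.ext_iff.1 hUF _).2 ⟨hmem, hτU⟩
  obtain ⟨γ₁, hγ₁, rfl⟩ := M.proj_eq_iff.1 hv'.symm
  obtain ⟨γ₂, hγ₂, h2⟩ := M.proj_eq_iff.1 hvc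
  have h3 : γ₂ (γ₁ v - c) = γ₂ (γ₁ v) - γ₂.linear c := by
    have := γ₂.map_vadd (γ₁ v) (-c)
    simp only [vadd_eq_add, map_neg] at this
    rw [show γ₁ v - c = -c + γ₁ v by abel, this]
    abel
  -- A causal displacement, so causality trivializes `γ₂ γ₁`; then two vectors of the cone add up to
  -- 0, which forces `τ u = 0`.
  have h4 : (γ₂ * γ₁) v - v = τ • u + γ₂.linear c := by
    rw [h3] at h2
    change γ₂ (γ₁ v) - v = _
    rw [sub_eq_iff_eq_add.1 h2]
    abel
  have h5 := M.smul_mem_cone hu hτ.le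
  have h6 := M.cone_linear γ₂ hγ₂ c hc
  have h7 := hM.1 _ (M.group.mul_mem hγ₂ hγ₁) v (h4 ▸ M.add_mem_cone h5 h6)
  rw [h7] at h4
  have h8 := M.eq_zero_of_add_eq_zero_of_mem_cone h5 h6 (by rw [← h4]; simp)
  rcases smul_eq_zero.1 h8 with h | h
  · exact hτ.ne' h
  · exact hne h

/-- The bijection of `V` with parameters `b`, `y`. -/
def actVec (M : FlatSpacetime V) (v₀ b y v : V) : V :=
  M.parabolic v₀ b v + (y - (1 / 2 * M.form b y) • v₀)

theorem act_eq_actVec (M : FlatSpacetime V) (v₀ : V) {T : Submodule ℝ V} (a : T →ₗ[ℝ] V) (x : T)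
    (v : V) : M.act v₀ a x v = M.actVec v₀ (a x) x v := rfl

end FlatSpacetime

namespace FlatSpacetime

/-! ### Existence of realizations -/

theorem affine_apply {V : Type*} [AddCommGroup V] [Module ℝ V] (γ : V ≃ᵃ[ℝ] V) (v : V) : γ v = γ.linear v + γ 0 := by
  have := γ.map_vadd 0 v
  simpa using this

variable {V : Type*} [NormedAddCommGroup V] [NormedSpace ℝ V] [FiniteDimensional ℝ V]

/-- A displacement in `-C` for `γ` is a displacement in `C` for `γ⁻¹`. -/
theorem IsCausal.eq_one_of_form_nonneg {M : FlatSpacetime V} (hM : M.IsCausal) {γ : V ≃ᵃ[ℝ] V}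
    (hγ : γ ∈ M.group) (v : V) (h : 0 ≤ M.form (γ v - v) (γ v - v)) : γ = 1 := by
  rcases M.mem_cone_or_neg_mem h with h | h
  · exact hM γ hγ v h
  · refine inv_eq_one.1 (hM γ⁻¹ (M.group.inv_mem hγ) (γ v) ?_)
    rw [neg_sub] at h
    exact (γ.symm_apply_apply v).symm ▸ h

/-- The translation vectors of `Γ`. -/
def translations (M : FlatSpacetime V) : AddSubgroup V where
  carrier := {x | ∃ γ ∈ M.group, ∀ v, γ v = v + x}
  zero_mem' := ⟨1, M.group.one_mem, fun v => (add_zero v).symm⟩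
  add_mem' := by
    rintro x y ⟨γ, hγ, h⟩ ⟨δ, hδ, h'⟩
    refine ⟨γ * δ, M.group.mul_mem hγ hδ, fun v => ?_⟩
    change γ (δ v) = _
    rw [h, h']; abel
  neg_mem' := by
    rintro x ⟨γ, hγ, h⟩
    refine ⟨γ⁻¹, M.group.inv_mem hγ, fun v => γ.injective ?_⟩
    have e : γ (γ⁻¹ v) = v := γ.apply_symm_apply v
    rw [e, h]; abel

theorem finite_translations (M : FlatSpacetime V) :
    {x | x ∈ M.translations ∧ ‖x‖ ≤ 1}.Finite := by
  refine ((M.proper _ (isCompact_closedBall (0 : V) 1)).image fun γ => γ 0).subset ?_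
  rintro x ⟨⟨γ, hγ, h⟩, hx⟩
  have h0 : γ 0 = x := by rw [h, zero_add]
  refine ⟨γ, ⟨hγ, x, ⟨0, by simp, h0⟩, by simpa using hx⟩, h0⟩

/-- A nonzero causal vector in the span of the translations would be the direction of a ray
approximated by lattice vectors, contrary to `not_recurrent`. In the elliptic frame `v₀` and `v₁`
play no role and are set to 0. -/
theorem IsStrictlyCausal.realization_of_translations {M : FlatSpacetime V}
    (hM : M.IsStrictlyCausal) (htriv : ∀ γ ∈ M.group, ∀ v, γ.linear v = v) :
    Nonempty M.Realization := by
  obtain ⟨m, b, hb⟩ := M.translations.exists_basis_of_finite_inter_ball M.finite_translations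
  have hact : ∀ x v, M.act 0 (0 : Submodule.span ℝ (M.translations : Set V) →ₗ[ℝ] V) x v
      = v + x := by
    intro x v; simp [act]
  refine ⟨⟨0, 0, 0, Submodule.span ℝ (M.translations : Set V), 0, m, b, Or.inr ⟨rfl, ?_⟩,
    by simp, by simp, fun γ => ?_⟩⟩
  · intro u hu huC
    by_contra hne
    refine hM.not_recurrent (v := 0) huC hne fun ε hε T => ?_
    obtain ⟨x, ⟨γ, hγ, h⟩, t, ht, hlt⟩ := M.translations.exists_near_ray b hb hu hε T
    exact ⟨γ, hγ, t, ht, by rwa [h, zero_add, sub_zero]⟩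
  · have hsum : ∀ z : Fin m → ℤ, ((∑ i, (z i : ℝ) • b i : Submodule.span ℝ _) : V)
        = ∑ i, (z i : ℝ) • (b i : V) := by intro z; simp
    simp only [zero_add, hact]
    constructor
    · intro hγ
      obtain ⟨z, hz⟩ := (hb (γ 0)).1 ⟨γ, hγ, fun v => by rw [affine_apply γ v, htriv γ hγ]⟩
      exact ⟨z, fun v => by rw [hsum, ← hz, affine_apply γ v, htriv γ hγ]⟩
    · rintro ⟨z, hz⟩
      obtain ⟨δ, hδ, h⟩ := (hb _).2 ⟨z, rfl⟩
      have : γ = δ := by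
        ext v
        rw [hz, h, hsum]
      exact this ▸ hδ

theorem parabolic_parabolic (M : FlatSpacetime V) {v₀ b b' : V} (h0 : M.form v₀ v₀ = 0)
    (hb : M.form v₀ b = 0) (hb' : M.form v₀ b' = 0) (v : V) :
    M.parabolic v₀ b (M.parabolic v₀ b' v) = M.parabolic v₀ (b + b') v := by
  have hs := M.form_symm
  simp only [parabolic, map_add, map_sub, map_smul, LinearMap.add_apply, smul_eq_mul, h0, hb, hb',
    hs b v₀, hs b' b]
  module

/-- The composition law of a Heisenberg group, with the translations along `v₀` as its center. -/
theorem actVec_actVec (M : FlatSpacetime V) {v₀ b b' y y' : V} (h0 : M.form v₀ v₀ = 0)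
    (hb : M.form v₀ b = 0) (hb' : M.form v₀ b' = 0) (hy' : M.form v₀ y' = 0) (v : V) :
    M.actVec v₀ b y (M.actVec v₀ b' y' v) = M.actVec v₀ (b + b') (y + y') v
      + (1 / 2 * (M.form b' y - M.form b y')) • v₀ := by
  have hs := M.form_symm
  have h1 : M.parabolic v₀ b (M.parabolic v₀ b' v + (y' - (1 / 2 * M.form b' y') • v₀))
      = M.parabolic v₀ b (M.parabolic v₀ b' v) + (y' - (1 / 2 * M.form b' y') • v₀)
        - M.form b y' • v₀ := by
    simp only [parabolic, map_add, map_sub, map_smul, smul_eq_mul, h0, hb, hb', hy', hs b v₀]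
    module
  rw [actVec, actVec, h1, M.parabolic_parabolic h0 hb hb', actVec]
  simp only [map_add, LinearMap.add_apply]
  module

theorem actVec_zero (M : FlatSpacetime V) (v₀ v : V) : M.actVec v₀ 0 0 v = v := by
  simp [actVec, parabolic]

/-- `γ` is the transformation with parameters `b ⊥ v₀, v₁` and `y ⊥ v₀`. -/
def HasParameters (M : FlatSpacetime V) (v₀ v₁ : V) (γ : V ≃ᵃ[ℝ] V) (b y : V) : Prop :=
  M.form v₀ b = 0 ∧ M.form v₁ b = 0 ∧ M.form v₀ y = 0 ∧ ∀ v, γ v = M.actVec v₀ b y v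

/-- If the holonomy group is not trivial then the group preserves the function `ℓ(v₀, ·)`. -/
theorem IsCausal.exists_parameters {M : FlatSpacetime V} (hM : M.IsCausal) (hMu : M.IsUnipotent)
    {v₀ v₁ : V} (h0 : M.form v₀ v₀ = 0) (h1 : M.form v₁ v₁ = 0) (h01 : M.form v₀ v₁ = 1)
    (hfix : ∀ γ ∈ M.group, γ.linear v₀ = v₀)
    (hnt : ∃ γ ∈ M.group, ∃ v, γ.linear v ≠ v) {γ : V ≃ᵃ[ℝ] V} (hγ : γ ∈ M.group) :
    ∃ b y, M.HasParameters v₀ v₁ γ b y := by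
  have hs := M.form_symm
  have key : ∀ γ ∈ M.group, ∀ b, M.form v₀ b = 0 → M.form v₁ b = 0 →
      (∀ v, γ.linear v = M.parabolic v₀ b v) → b ≠ 0 → M.form v₀ (γ 0) = 0 := by
    intro γ hγ b hb0 hb1 hlin hne
    by_contra hh
    have hbb := M.form_neg_of_perp h0 h1 h01 hb0 hb1 hne
    set c := γ 0 with hc
    -- Along `ℝ b` the square of the displacement is an affine function of `r` with nonzero slope;
    -- this `r` makes it equal to 1, which causality forbids.
    set r := (M.form c c - 1) / (2 * M.form b b * M.form v₀ c) with hr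
    have hrr : 2 * (r * M.form b b) * M.form v₀ c = M.form c c - 1 := by
      rw [hr]
      field_simp [hbb.ne]
    have e : γ (r • b) - r • b = c - (r * M.form b b) • v₀ := by
      rw [affine_apply, hlin, parabolic]
      simp only [map_smul, smul_eq_mul, hb0]
      module
    have hval : M.form (γ (r • b) - r • b) (γ (r • b) - r • b) = 1 := by
      rw [e]
      simp only [map_sub, map_smul, LinearMap.sub_apply, LinearMap.smul_apply, smul_eq_mul, h0,
        hs c v₀]
      linarith
    have h1 := hM.eq_one_of_form_nonneg hγ (r • b) (by rw [hval]; norm_num)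
    rw [h1] at hval
    simp at hval
  obtain ⟨b, hb0, hb1, hlin⟩ := hMu.linear_eq h0 h1 h01 hγ (hfix γ hγ)
  have hc : M.form v₀ (γ 0) = 0 := by
    by_cases hb : b = 0
    -- A pure translation is handled by composing it with an element of nontrivial linear part.
    · obtain ⟨γ₁, hγ₁, w, hw⟩ := hnt
      obtain ⟨b₁, hb₁0, hb₁1, hlin₁⟩ := hMu.linear_eq h0 h1 h01 hγ₁ (hfix γ₁ hγ₁)
      have hb₁ : b₁ ≠ 0 := by
        rintro rfl
        exact hw (by rw [hlin₁]; simp [parabolic])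
      have e1 : ∀ v, γ v = v + γ 0 := fun v => by
        rw [affine_apply γ v, hlin, hb]; simp [parabolic]
      have h2 := key (γ * γ₁) (M.group.mul_mem hγ hγ₁) b₁ hb₁0 hb₁1 (fun v => by
        change γ.linear (γ₁.linear v) = _
        rw [hlin, hb, hlin₁]; simp [parabolic]) hb₁
      change M.form v₀ (γ (γ₁ 0)) = 0 at h2
      rwa [e1, map_add, key γ₁ hγ₁ b₁ hb₁0 hb₁1 hlin₁ hb₁, zero_add] at h2
    · exact key γ hγ b hb0 hb1 hlin hb
  -- The correction makes `y - (ℓ(b, y) / 2) v₀` equal to `γ 0`, as `b ⊥ v₀`.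
  refine ⟨b, γ 0 + (1 / 2 * M.form b (γ 0)) • v₀, hb0, hb1, ?_, fun v => ?_⟩
  · simp [hc, h0]
  · rw [affine_apply γ v, hlin, actVec]
    simp only [map_add, map_smul, smul_eq_mul, hs b v₀, hb0]
    module

/-- The commutator of `γ` and `γ'` displaces a point by `(ℓ(b', y) - ℓ(b, y')) v₀`, an isotropic
vector; causality makes it vanish. -/
theorem HasParameters.symplectic {M : FlatSpacetime V} (hM : M.IsCausal) {v₀ v₁ : V}
    (h0 : M.form v₀ v₀ = 0) (hne : v₀ ≠ 0) {γ γ' : V ≃ᵃ[ℝ] V} (hγ : γ ∈ M.group)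
    (hγ' : γ' ∈ M.group) {b y b' y' : V} (h : M.HasParameters v₀ v₁ γ b y)
    (h' : M.HasParameters v₀ v₁ γ' b' y') : M.form b y' = M.form b' y := by
  obtain ⟨hb, -, hy, e⟩ := h
  obtain ⟨hb', -, hy', e'⟩ := h'
  have c1 : γ (γ' 0) = M.actVec v₀ (b + b') (y + y') 0
      + (1 / 2 * (M.form b' y - M.form b y')) • v₀ := by
    rw [e', e, M.actVec_actVec h0 hb hb' hy']
  have c2 : γ' (γ 0) = M.actVec v₀ (b + b') (y + y') 0
      + (1 / 2 * (M.form b y' - M.form b' y)) • v₀ := by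
    rw [e, e', M.actVec_actVec h0 hb' hb hy, add_comm b' b, add_comm y' y]
  have hd : (γ * γ' * (γ' * γ)⁻¹) (γ' (γ 0)) - γ' (γ 0) = (M.form b' y - M.form b y') • v₀ := by
    have : (γ * γ' * (γ' * γ)⁻¹) (γ' (γ 0)) = γ (γ' 0) :=
      congrArg (γ * γ') ((γ' * γ).symm_apply_apply 0)
    rw [this, c1, c2]
    module
  have h1 := hM.eq_one_of_form_nonneg (M.group.mul_mem (M.group.mul_mem hγ hγ')
    (M.group.inv_mem (M.group.mul_mem hγ' hγ))) (γ' (γ 0)) (by rw [hd]; simp [h0])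
  rw [h1] at hd
  have : (M.form b' y - M.form b y') • v₀ = 0 := by rw [← hd]; simp
  rcases smul_eq_zero.1 this with h | h
  · linarith
  · exact absurd h hne

/-- The values at `v₁` and at 0 give `b` and `y` up to multiples of `v₀`. Pairing with `v₁` removes
the ambiguity of `b`; pairing with `b` then removes that of `y`. -/
theorem HasParameters.unique {M : FlatSpacetime V} {v₀ v₁ : V} (h01 : M.form v₀ v₁ = 1)
    {γ : V ≃ᵃ[ℝ] V} {b y b' y' : V} (h : M.HasParameters v₀ v₁ γ b y)
    (h' : M.HasParameters v₀ v₁ γ b' y') : b = b' ∧ y = y' := by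
  obtain ⟨hb0, hb1, hy, e⟩ := h
  obtain ⟨hb0', hb1', hy', e'⟩ := h'
  have hs := M.form_symm
  have hz : ∀ v : V, M.actVec v₀ b y v = M.actVec v₀ b' y' v := fun v => (e v).symm.trans (e' v)
  have hz0 := hz 0
  have hz1 := hz v₁
  simp only [actVec, parabolic, map_zero, zero_smul, zero_add, sub_zero, add_zero, mul_zero,
    zero_mul] at hz0
  simp only [actVec] at hz1
  rw [hz0] at hz1
  have hp := add_right_cancel hz1
  simp only [parabolic, hs b v₁, hs b' v₁, hb1, hb1', h01] at hp
  have hbb : b = b' + (1 / 2 * M.form b b - 1 / 2 * M.form b' b') • v₀ := by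
    linear_combination (norm := module) (1 : ℝ) • hp
  have hc := congrArg (M.form v₁) hbb
  simp only [map_add, map_smul, hb1, hb1', hs v₁ v₀, h01, smul_eq_mul, mul_one, zero_add] at hc
  rw [← hc, zero_smul, add_zero] at hbb
  subst hbb
  refine ⟨rfl, ?_⟩
  have hy2 : y = y' + (1 / 2 * M.form b y - 1 / 2 * M.form b y') • v₀ := by
    linear_combination (norm := module) (1 : ℝ) • hz0
  have hc2 := congrArg (M.form b) hy2
  simp only [map_add, map_smul, hs b v₀, hb0, smul_eq_mul, mul_zero, add_zero] at hc2
  rw [hy2, hc2]; simp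

/-- The parameters of the elements of `Γ`. -/
def parameters {M : FlatSpacetime V} (hM : M.IsCausal) {v₀ : V} (v₁ : V)
    (h0 : M.form v₀ v₀ = 0) (hne : v₀ ≠ 0) : AddSubgroup (V × V) where
  carrier := {p | ∃ γ ∈ M.group, M.HasParameters v₀ v₁ γ p.1 p.2}
  zero_mem' := ⟨1, M.group.one_mem, by simp, by simp, by simp,
    fun v => (M.actVec_zero v₀ v).symm⟩
  add_mem' := by
    rintro ⟨b, y⟩ ⟨b', y'⟩ ⟨γ, hγ, h⟩ ⟨γ', hγ', h'⟩
    have hsym := HasParameters.symplectic hM h0 hne hγ hγ' h h'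
    obtain ⟨hb, hb1, hy, e⟩ := h
    obtain ⟨hb', hb1', hy', e'⟩ := h'
    refine ⟨γ * γ', M.group.mul_mem hγ hγ', by simp [hb, hb'], by simp [hb1, hb1'],
      by simp [hy, hy'], fun v => ?_⟩
    change γ (γ' v) = _
    rw [e', e, M.actVec_actVec h0 hb hb' hy', hsym]
    simp
  neg_mem' := by
    rintro ⟨b, y⟩ ⟨γ, hγ, hb, hb1, hy, e⟩
    refine ⟨γ⁻¹, M.group.inv_mem hγ, by simpa using hb, by simpa using hb1, by simpa using hy,
      fun v => γ.injective ?_⟩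
    have : γ (γ⁻¹ v) = v := γ.apply_symm_apply v
    rw [this, e, M.actVec_actVec h0 hb (by simpa using hb) (by simpa using hy)]
    simp [actVec_zero]

end FlatSpacetime

/-! ### Flows in the real span of the parameters -/

namespace FlatSpacetime

variable {V : Type*} [NormedAddCommGroup V] [NormedSpace ℝ V] [FiniteDimensional ℝ V]

theorem continuous_actVec (M : FlatSpacetime V) (v₀ v : V) :
    Continuous fun p : V × V => M.actVec v₀ p.1 p.2 v := by
  have h1 : Continuous fun p : V × V => M.form p.1 v :=
    M.form_continuous continuous_fst continuous_const
  have h2 : Continuous fun p : V × V => M.form p.1 p.1 :=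
    M.form_continuous continuous_fst continuous_fst
  have h3 : Continuous fun p : V × V => M.form p.1 p.2 :=
    M.form_continuous continuous_fst continuous_snd
  unfold actVec parabolic
  fun_prop

/-- Bounded parameters move 0 within a bounded set, so properness leaves finitely many `γ`, each
with at most one pair of parameters. -/
theorem finite_parameters {M : FlatSpacetime V} (hM : M.IsCausal) {v₀ v₁ : V}
    (h0 : M.form v₀ v₀ = 0) (h01 : M.form v₀ v₁ = 1) (hne : v₀ ≠ 0) :
    {p | p ∈ parameters hM v₁ h0 hne ∧ ‖p‖ ≤ 1}.Finite := by
  obtain ⟨R, hR⟩ := ((isCompact_closedBall (0 : V × V) 1).image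
    (M.continuous_actVec v₀ 0)).isBounded.subset_closedBall 0
  have hR0 : 0 ≤ R := by
    have := hR ⟨0, by simp, rfl⟩
    exact dist_nonneg.trans (Metric.mem_closedBall.1 this)
  refine ((M.proper _ (isCompact_closedBall (0 : V) R)).biUnion
    (t := fun γ => {p : V × V | M.HasParameters v₀ v₁ γ p.1 p.2}) fun γ _ =>
      Set.Subsingleton.finite fun p hp q hq =>
        Prod.ext (hp.unique h01 hq).1 (hp.unique h01 hq).2).subset ?_
  rintro p ⟨⟨γ, hγ, h⟩, hp⟩
  refine Set.mem_biUnion (x := γ) ⟨hγ, γ 0, ⟨0, by simpa using hR0, rfl⟩, ?_⟩ h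
  rw [h.2.2.2]
  exact hR ⟨p, by simpa using hp, rfl⟩

/-- The flow with the parameters `t (b, y)` moves the points `v` with `ℓ(v₀, v) b + y ∈ ℝ v₀`
along `v₀`. -/
theorem actVec_flow (M : FlatSpacetime V) {v₀ b y β η v : V} {s κ t : ℝ}
    (hb : M.form v₀ b = 0) (hβ : M.form v₀ β = 0)
    (hsym : M.form b η = M.form β y) (hy : s • b + y = κ • v₀) (hv : M.form v₀ v = s) :
    M.actVec v₀ (t • b + β) (t • y + η) v
      = M.actVec v₀ β η v + (t * (κ - M.form b v)) • v₀ := by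
  have hs := M.form_symm
  obtain rfl : y = κ • v₀ - s • b := eq_sub_of_add_eq' hy
  have hbη : M.form b η = - s * M.form β b := by
    rw [hsym, map_sub, map_smul, map_smul, hs β v₀, hβ]; simp
  simp only [actVec, parabolic, map_add, map_sub, map_smul, LinearMap.add_apply,
    LinearMap.smul_apply, smul_eq_mul, hv, hbη, hs b v₀, hs β v₀, hb, hβ, hs b β]
  module

theorem parameters_span {M : FlatSpacetime V} (hM : M.IsCausal) {v₀ v₁ : V}
    (h0 : M.form v₀ v₀ = 0) (hne : v₀ ≠ 0) {p : V × V}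
    (hp : p ∈ Submodule.span ℝ (parameters hM v₁ h0 hne : Set (V × V))) :
    M.form v₀ p.1 = 0 ∧ M.form v₁ p.1 = 0 ∧ M.form v₀ p.2 = 0 := by
  induction hp using Submodule.span_induction with
  | mem p h => obtain ⟨γ, -, h1, h2, h3, -⟩ := h; exact ⟨h1, h2, h3⟩
  | zero => simp
  | add p q _ _ h h' => simp [h, h']
  | smul c p _ h => simp [h]

theorem parameters_span_symplectic {M : FlatSpacetime V} (hM : M.IsCausal) {v₀ v₁ : V}
    (h0 : M.form v₀ v₀ = 0) (hne : v₀ ≠ 0) {p q : V × V}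
    (hp : p ∈ Submodule.span ℝ (parameters hM v₁ h0 hne : Set (V × V)))
    (hq : q ∈ Submodule.span ℝ (parameters hM v₁ h0 hne : Set (V × V))) :
    M.form p.1 q.2 = M.form q.1 p.2 := by
  induction hp, hq using Submodule.span_induction₂ with
  | mem_mem p q h h' =>
    obtain ⟨γ, hγ, h⟩ := h
    obtain ⟨γ', hγ', h'⟩ := h'
    exact h.symplectic hM h0 hne hγ hγ' h'
  | zero_left => simp
  | zero_right => simp
  | add_left p q r _ _ _ h h' => simp [h, h']
  | add_right p q r _ _ _ h h' => simp [h, h']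
  | smul_left c p q _ _ h => simp [h]
  | smul_right c p q _ _ h => simp [h]

/-- On the level `l₀ = s` the flow of `p` moves each point along `v₀` with a constant speed. Strict
causality excludes a positive speed for `p` and for `-p`, so all speeds on this level vanish. -/
theorem IsStrictlyCausal.parameters_eq_zero {M : FlatSpacetime V} (hM : M.IsStrictlyCausal)
    {v₀ v₁ : V} (hC : v₀ ∈ M.cone) (h0 : M.form v₀ v₀ = 0) (hne : v₀ ≠ 0)
    (h1 : M.form v₁ v₁ = 0) (h01 : M.form v₀ v₁ = 1) {p : V × V}
    (hp : p ∈ Submodule.span ℝ (parameters hM.1 v₁ h0 hne : Set (V × V))) {s κ : ℝ}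
    (hs : s • p.1 + p.2 = κ • v₀) : p = 0 := by
  have hsym := M.form_symm
  obtain ⟨m, B, hB⟩ := (parameters hM.1 v₁ h0 hne).exists_basis_of_finite_inter_ball
    (finite_parameters hM.1 h0 h01 hne)
  -- A lattice element near `t p` differs from the flow by a small parameter `x - t p`, which nearly
  -- fixes `v`; a positive speed would thus make the orbit of `v` recur along `v₀`.
  have key : ∀ p ∈ Submodule.span ℝ (parameters hM.1 v₁ h0 hne : Set (V × V)), ∀ κ : ℝ, ∀ v : V,
      s • p.1 + p.2 = κ • v₀ → M.form v₀ v = s → κ - M.form p.1 v ≤ 0 := by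
    intro p hp κ v hκ hv
    by_contra! hpos
    refine hM.not_recurrent (v := v) (M.smul_mem_cone hC hpos.le)
      (smul_ne_zero hpos.ne' hne) fun ε hε T => ?_
    have hcont := (M.continuous_actVec v₀ v).tendsto 0
    rw [Metric.tendsto_nhds_nhds] at hcont
    obtain ⟨δ, hδ, hclose⟩ := hcont ε hε
    obtain ⟨x, hx, t, ht, hlt⟩ := (parameters hM.1 v₁ h0 hne).exists_near_ray B hB hp hδ T
    obtain ⟨γ, hγ, hb, hb1, hy, e⟩ := id hx
    have hq : x - t • p ∈ Submodule.span ℝ (parameters hM.1 v₁ h0 hne : Set (V × V)) :=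
      sub_mem (Submodule.subset_span hx) (Submodule.smul_mem _ _ hp)
    have hd := hclose (x := x - t • p) (by rwa [dist_zero_right])
    refine ⟨γ, hγ, t, ht, ?_⟩
    have hflow := M.actVec_flow (v := v) (t := t) (parameters_span hM.1 h0 hne hp).1
      (parameters_span hM.1 h0 hne hq).1
      (parameters_span_symplectic hM.1 h0 hne hp hq) hκ hv
    have hx1 : t • p.1 + (x - t • p).1 = x.1 := by simp
    have hx2 : t • p.2 + (x - t • p).2 = x.2 := by simp
    rw [hx1, hx2] at hflow
    rw [e, hflow, smul_smul, add_sub_cancel_right, ← dist_eq_norm]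
    simpa [actVec_zero] using hd
  obtain ⟨hb0, hb1, hy⟩ := parameters_span hM.1 h0 hne hp
  -- The speed `κ - ℓ(b, v)` is tested at the points `s v₁ + r b` of the level.
  have hall : ∀ r : ℝ, κ = r * M.form p.1 p.1 := by
    intro r
    have hv : M.form v₀ (s • v₁ + r • p.1) = s := by simp [h01, hb0]
    have e : M.form p.1 (s • v₁ + r • p.1) = r * M.form p.1 p.1 := by
      simp [hsym p.1 v₁, hb1]
    have i1 := key p hp κ _ hs hv
    have i2 := key (-p) (neg_mem hp) (-κ) _ (by
      simp only [Prod.fst_neg, Prod.snd_neg, neg_smul, ← hs]; module) hv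
    simp only [Prod.fst_neg, map_neg, LinearMap.neg_apply] at i2
    rw [e] at i1 i2
    linarith
  have hκ : κ = 0 := by simpa using hall 0
  have hbb : M.form p.1 p.1 = 0 := by simpa [hκ] using (hall 1).symm
  have hb : p.1 = 0 := by
    by_contra h
    exact (M.form_neg_of_perp h0 h1 h01 hb0 hb1 h).ne hbb
  rw [hb, hκ, smul_zero, zero_smul, zero_add] at hs
  exact Prod.ext hb hs

/-- This freedom in `b` permits replacing `v₁` by another isotropic vector without changing the
group. -/
theorem actVec_sub_smul (M : FlatSpacetime V) {v₀ b y : V} (h0 : M.form v₀ v₀ = 0)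
    (hb : M.form v₀ b = 0) (hy : M.form v₀ y = 0) (c : ℝ) (v : V) :
    M.actVec v₀ (b - c • v₀) y v = M.actVec v₀ b y v := by
  simp only [actVec, parabolic, map_sub, map_smul, LinearMap.sub_apply,
    LinearMap.smul_apply, smul_eq_mul, h0, hb, hy, M.form_symm b v₀]
  module

theorem IsStrictlyCausal.realization_of_nontrivial {M : FlatSpacetime V}
    (hM : M.IsStrictlyCausal) (hMu : M.IsUnipotent) {v₀ : V} (hC : v₀ ∈ M.cone)
    (h0 : M.form v₀ v₀ = 0) (hne : v₀ ≠ 0) (hfix : ∀ γ ∈ M.group, γ.linear v₀ = v₀)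
    (hnt : ∃ γ ∈ M.group, ∃ v, γ.linear v ≠ v) : Nonempty M.Realization := by
  have hsym := M.form_symm
  obtain ⟨v₁, h1, h01⟩ : ∃ v₁, M.form v₁ v₁ = 0 ∧ M.form v₀ v₁ = 1 := by
    by_contra! hcon
    refine hne (M.eq_zero_of_form_eq_zero fun w => ?_)
    by_contra hw
    obtain ⟨v₁, -, h1, h2, -⟩ := M.exists_isotropic hC h0 hw
    exact hcon v₁ h1 h2
  set Λ := parameters hM.1 v₁ h0 hne with hΛ
  set S := Submodule.span ℝ (Λ : Set (V × V)) with hS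
  obtain ⟨m, B, hB⟩ := Λ.exists_basis_of_finite_inter_ball (finite_parameters hM.1 h0 h01 hne)
  have hzero : ∀ p ∈ S, ∀ s κ : ℝ, s • p.1 + p.2 = κ • v₀ → p = 0 :=
    fun p hp s κ h => hM.parameters_eq_zero hC h0 hne h1 h01 hp h
  -- `T` is the space of second components `y`. A pair with `y = 0` is zero by the case `s = κ = 0`
  -- of `hzero`, so `b` is a linear function of `y`.
  set π : S →ₗ[ℝ] V := LinearMap.snd ℝ V V ∘ₗ S.subtype with hπ
  have hinj : Function.Injective π := by
    rw [injective_iff_map_eq_zero]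
    intro p hp
    refine Subtype.ext (hzero p p.2 0 0 ?_)
    simpa [hπ] using hp
  set e : S ≃ₗ[ℝ] LinearMap.range π := LinearEquiv.ofInjective π hinj with he
  have hev : ∀ x, ((e.symm x : S) : V × V).2 = x := fun x => by
    have := congrArg Subtype.val (e.apply_symm_apply x)
    exact this
  -- The vector `v₁` need not be orthogonal to `T`. Since `v₀ ∉ T`, by the case `s = 0`, `κ = 1` of
  -- `hzero`, some `w ⊥ T` is not orthogonal to `v₀`, and it yields an isotropic `v₂ ⊥ T`.
  obtain ⟨w, hw, hw0⟩ : ∃ w ∈ M.form.orthogonal (LinearMap.range π), M.form v₀ w ≠ 0 := by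
    by_contra! hcon
    have hmem : v₀ ∈ LinearMap.range π := by
      rw [← M.form.orthogonal_orthogonal M.form_nondegenerate M.form_isRefl (LinearMap.range π)]
      intro w hw
      exact (hsym w v₀).trans (hcon w hw)
    obtain ⟨p, hp⟩ := hmem
    have := hzero p p.2 0 1 (by simpa [hπ] using hp)
    rw [← hp] at hne
    exact hne (by simp [hπ, this])
  obtain ⟨v₂, hC2, h2, h02, c, d, hv₂⟩ := M.exists_isotropic hC h0 hw0
  have hT0 : ∀ x : LinearMap.range π, M.form v₀ x = 0 := fun x => by
    rw [← hev x]; exact (parameters_span hM.1 h0 hne (e.symm x).2).2.2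
  have hT2 : ∀ x : LinearMap.range π, M.form v₂ x = 0 := fun x => by
    have hwx : M.form w x = 0 := (hsym w x).trans (hw x x.2)
    rw [hv₂, map_add, map_smul, map_smul]
    simp [hwx, hT0 x]
  set a₀ : LinearMap.range π →ₗ[ℝ] V := LinearMap.fst ℝ V V ∘ₗ S.subtype ∘ₗ e.symm.toLinearMap
    with ha₀
  have ha₀v : ∀ x, a₀ x = ((e.symm x : S) : V × V).1 := fun x => rfl
  have ha₀0 : ∀ x, M.form v₀ (a₀ x) = 0 := fun x => (parameters_span hM.1 h0 hne (e.symm x).2).1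
  -- The correction along `v₀` makes the values orthogonal to `v₂`.
  set a : LinearMap.range π →ₗ[ℝ] V := a₀ - (M.form v₂ ∘ₗ a₀).smulRight v₀ with ha
  have hav : ∀ x, a x = a₀ x - M.form v₂ (a₀ x) • v₀ := fun x => rfl
  have hact : ∀ x v, M.act v₀ a x v = M.actVec v₀ (a₀ x) x v := by
    intro x v
    rw [act_eq_actVec, hav, M.actVec_sub_smul h0 (ha₀0 x) (hT0 x)]
  have hax : ∀ x y : LinearMap.range π, M.form (a x) y = M.form (a₀ x) y := by
    intro x y
    rw [hav, map_sub, map_smul]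
    simp [hT0 y]
  have hsum : ∀ z : Fin m → ℤ, ((e.symm (∑ i, (z i : ℝ) • (B.map e) i) : S) : V × V)
      = ∑ i, (z i : ℝ) • (B i : V × V) := by
    intro z
    simp [map_sum]
  refine ⟨⟨0, v₀, v₂, LinearMap.range π, a, m, B.map e, Or.inl ⟨hC, hC2, h0, h2, h02,
    fun x => ⟨hT0 x, hT2 x⟩, fun x => ?_⟩, fun x y => ?_, fun s x hx => ?_, fun γ => ?_⟩⟩
  · rw [hav]
    simp [ha₀0, h0, hsym v₂ v₀, h02]
  · rw [hax, hsym x (a y), hax]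
    have := parameters_span_symplectic hM.1 h0 hne (e.symm x).2 (e.symm y).2
    rwa [hev, hev] at this
  · have : s • a₀ x + (x : V) = (s * M.form v₂ (a₀ x)) • v₀ := by
      rw [hav, smul_sub, ← add_sub_assoc, sub_eq_zero, smul_smul] at hx
      rw [← hx, add_comm]
    have h3 := hzero _ (e.symm x).2 s (s * M.form v₂ (a₀ x)) (by rw [hev, ← ha₀v]; exact this)
    exact e.symm.injective (Subtype.ext (by rw [h3]; simp))
  · simp only [zero_add, hact]
    constructor
    · intro hγ
      obtain ⟨b, y, h⟩ := hM.1.exists_parameters hMu h0 h1 h01 hfix hnt hγ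
      obtain ⟨z, hz⟩ := (hB (b, y)).1 ⟨γ, hγ, h⟩
      refine ⟨z, fun v => ?_⟩
      rw [ha₀v, ← hev (∑ i, (z i : ℝ) • (B.map e) i), hsum, ← hz]
      exact h.2.2.2 v
    · rintro ⟨z, hz⟩
      obtain ⟨δ, hδ, h⟩ := (hB _).2 ⟨z, rfl⟩
      have : γ = δ := by
        ext v
        rw [hz, h.2.2.2, ha₀v, ← hev (∑ i, (z i : ℝ) • (B.map e) i), hsum]
      exact this ▸ hδ

theorem IsStrictlyCausal.nonempty_realization {M : FlatSpacetime V}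
    (hM : M.IsStrictlyCausal) (hMu : M.IsUnipotent) : Nonempty M.Realization := by
  by_cases htriv : ∀ γ ∈ M.group, ∀ v, γ.linear v = v
  · exact hM.realization_of_translations htriv
  · obtain ⟨v₀, hC, hne, h0, hfix⟩ := hMu.trivial_or_isotropic.resolve_left htriv
    push Not at htriv
    exact hM.realization_of_nontrivial hMu hC h0 hne hfix htriv

end FlatSpacetime

namespace FlatSpacetime

variable {V : Type*} [NormedAddCommGroup V] [NormedSpace ℝ V] [FiniteDimensional ℝ V]
variable {V' : Type*} [NormedAddCommGroup V'] [NormedSpace ℝ V'] [FiniteDimensional ℝ V']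

/-! ### Extension of isometries -/

/-- An orthonormal frame of a negative definite subspace. -/
theorem exists_orthonormal_frame (M : FlatSpacetime V) (K : Submodule ℝ V)
    (hK : ∀ x ∈ K, x ≠ 0 → M.form x x < 0) {k : ℕ} (hk : Module.finrank ℝ K = k) :
    ∃ g : (Fin k → ℝ) →ₗ[ℝ] V, LinearMap.range g = K ∧
      ∀ c d, M.form (g c) (g d) = - ∑ i, c i * d i := by
  obtain ⟨b, hb⟩ := LinearMap.BilinForm.exists_orthogonal_basis (B := M.form.restrict K)
    ⟨fun x y => M.form_symm x y⟩
  subst hk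
  set r : Fin (Module.finrank ℝ K) → ℝ := fun i => Real.sqrt (-M.form (b i) (b i)) with hr
  have hneg : ∀ i, M.form (b i) (b i) < 0 := fun i =>
    hK _ (b i).2 fun h => b.ne_zero i (Subtype.ext h)
  have hr0 : ∀ i, r i ≠ 0 := fun i => (Real.sqrt_pos.2 (by linarith [hneg i])).ne'
  have hrr : ∀ i, r i * r i = -M.form (b i) (b i) := fun i =>
    Real.mul_self_sqrt (by linarith [hneg i])
  have horth : ∀ i j, i ≠ j → M.form (b i) (b j) = 0 := fun i j h => hb h
  set σ : (Fin (Module.finrank ℝ K) → ℝ) →ₗ[ℝ] (Fin (Module.finrank ℝ K) → ℝ) :=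
    LinearMap.pi fun i => (r i)⁻¹ • LinearMap.proj i with hσ
  refine ⟨K.subtype ∘ₗ b.equivFun.symm.toLinearMap ∘ₗ σ, ?_, fun c d => ?_⟩
  · have hs : Function.Surjective σ := fun c => ⟨fun i => r i * c i, by
      ext i
      simp [hσ, hr0 i]⟩
    rw [LinearMap.range_comp_of_range_eq_top, Submodule.range_subtype]
    rw [LinearMap.range_eq_top]
    exact b.equivFun.symm.surjective.comp hs
  · have e : ∀ c, (K.subtype ∘ₗ b.equivFun.symm.toLinearMap ∘ₗ σ) c
        = ∑ i, ((r i)⁻¹ * c i) • (b i : V) := by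
      intro c
      simp [hσ, Module.Basis.equivFun_symm_apply]
    simp only [e, map_sum, LinearMap.sum_apply, map_smul, LinearMap.smul_apply, smul_eq_mul]
    rw [← Finset.sum_neg_distrib]
    refine Finset.sum_congr rfl fun i _ => ?_
    rw [Finset.sum_eq_single i]
    · have := hrr i
      have h3 := hr0 i
      rw [← neg_eq_iff_eq_neg] at this
      rw [← this]
      field_simp
    · intro j _ hj
      rw [horth _ _ hj]; ring
    · simp

theorem isCompl_orthogonal_of_timelike (M : FlatSpacetime V) (U : Submodule ℝ V) {u : V}
    (hu : u ∈ U) (huu : 0 < M.form u u) : IsCompl U (M.form.orthogonal U) := by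
  rw [LinearMap.BilinForm.isCompl_orthogonal_iff_disjoint M.form_isRefl, Submodule.disjoint_def]
  intro v hv hv'
  exact M.eq_zero_of_form_orthogonal huu (hv' u hu) (hv' v hv).ge

/-- Two surjections with equal Gram forms differ by an isometry. -/
theorem exists_isometry_of_surjective (M : FlatSpacetime V) (M' : FlatSpacetime V')
    {W : Type*} [AddCommGroup W] [Module ℝ W] (Φ : W →ₗ[ℝ] V) (Φ' : W →ₗ[ℝ] V')
    (hΦ : Function.Surjective Φ) (hΦ' : Function.Surjective Φ')
    (h : ∀ x y, M'.form (Φ' x) (Φ' y) = M.form (Φ x) (Φ y)) :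
    ∃ L : V ≃ₗ[ℝ] V', (∀ x y, M'.form (L x) (L y) = M.form x y) ∧ ∀ w, L (Φ w) = Φ' w := by
  -- By nondegeneracy both kernels are the radical of the same pulled back form.
  have hker : LinearMap.ker Φ = LinearMap.ker Φ' := by
    ext x
    simp only [LinearMap.mem_ker]
    constructor
    · intro hx
      refine M'.eq_zero_of_form_eq_zero fun w => ?_
      obtain ⟨y, rfl⟩ := hΦ' w
      rw [h, hx]; simp
    · intro hx
      refine M.eq_zero_of_form_eq_zero fun w => ?_
      obtain ⟨y, rfl⟩ := hΦ w
      rw [← h, hx]; simp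
  set L := (Φ.quotKerEquivOfSurjective hΦ).symm.trans
    ((Submodule.quotEquivOfEq _ _ hker).trans (Φ'.quotKerEquivOfSurjective hΦ')) with hL
  have hLΦ : ∀ w, L (Φ w) = Φ' w := by
    intro w
    have : (Φ.quotKerEquivOfSurjective hΦ).symm (Φ w) = Submodule.Quotient.mk w := by
      rw [LinearEquiv.symm_apply_eq]; rfl
    simp only [hL, LinearEquiv.trans_apply, this]
    rfl
  refine ⟨L, fun x y => ?_, hLΦ⟩
  obtain ⟨x, rfl⟩ := hΦ x
  obtain ⟨y, rfl⟩ := hΦ y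
  rw [hLΦ, hLΦ, h]

theorem mem_cone_of_isometry (M : FlatSpacetime V) (M' : FlatSpacetime V') (L : V →ₗ[ℝ] V')
    (hL : ∀ x y, M'.form (L x) (L y) = M.form x y) {u : V} (hu : u ∈ M.cone)
    (huu : 0 < M.form u u) (hLu : L u ∈ M'.cone) {x : V} (hx : x ∈ M.cone) : L x ∈ M'.cone :=
  M'.mem_cone_of_timelike hLu (by rwa [hL]) (by rw [hL]; exact M.form_self_nonneg hx)
    (by rw [hL]; exact M.form_nonneg hu hx)

/-- Two linear mappings with equal Gram forms whose ranges contain timelike vectors differ by an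
isometry that preserves the cones. -/
theorem exists_isometry_of_gram (M : FlatSpacetime V) (M' : FlatSpacetime V')
    (hn : Module.finrank ℝ V = Module.finrank ℝ V')
    {W : Type*} [AddCommGroup W] [Module ℝ W] (Φ : W →ₗ[ℝ] V) (Φ' : W →ₗ[ℝ] V')
    (h : ∀ x y, M'.form (Φ' x) (Φ' y) = M.form (Φ x) (Φ y)) {w : W} (hw : Φ w ∈ M.cone)
    (hw' : Φ' w ∈ M'.cone) (hww : 0 < M.form (Φ w) (Φ w)) :
    ∃ L : V ≃ₗ[ℝ] V', (∀ x y, M'.form (L x) (L y) = M.form x y) ∧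
      (∀ x ∈ M.cone, L x ∈ M'.cone) ∧ ∀ w, L (Φ w) = Φ' w := by
  have hww' : 0 < M'.form (Φ' w) (Φ' w) := by rwa [h]
  set U := LinearMap.range Φ with hU
  set U' := LinearMap.range Φ' with hU'
  have hwU : Φ w ∈ U := LinearMap.mem_range_self _ _
  have hwU' : Φ' w ∈ U' := LinearMap.mem_range_self _ _
  have hc := M.isCompl_orthogonal_of_timelike U hwU hww
  have hc' := M'.isCompl_orthogonal_of_timelike U' hwU' hww'
  have hker : LinearMap.ker Φ = LinearMap.ker Φ' := by
    ext x
    simp only [LinearMap.mem_ker]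
    constructor
    · intro hx
      refine M'.eq_zero_of_form_orthogonal hww' ?_ ?_ <;> rw [h, hx] <;> simp
    · intro hx
      refine M.eq_zero_of_form_orthogonal hww ?_ ?_ <;> rw [← h, hx] <;> simp
  have hUU : Module.finrank ℝ U = Module.finrank ℝ U' :=
    LinearEquiv.finrank_eq (Φ.quotKerEquivRange.symm.trans
      ((Submodule.quotEquivOfEq _ _ hker).trans Φ'.quotKerEquivRange))
  have hk : Module.finrank ℝ (M'.form.orthogonal U') = Module.finrank ℝ (M.form.orthogonal U) := by
    have h1 := Submodule.finrank_add_eq_of_isCompl hc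
    have h2 := Submodule.finrank_add_eq_of_isCompl hc'
    omega
  -- Complements of subspaces with timelike vectors are negative definite and here of equal
  -- dimension, so orthonormal frames identify them.
  obtain ⟨g, hg, hgg⟩ := M.exists_orthonormal_frame (M.form.orthogonal U)
    (fun x hx hne => M.form_neg_of_orthogonal hww (hx _ hwU) hne) rfl
  obtain ⟨g', hg', hgg'⟩ := M'.exists_orthonormal_frame (M'.form.orthogonal U')
    (fun x hx hne => M'.form_neg_of_orthogonal hww' (hx _ hwU') hne) hk
  have hperp : ∀ x c, M.form (Φ x) (g c) = 0 := fun x c =>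
    (hg.le (LinearMap.mem_range_self g c) : g c ∈ M.form.orthogonal U) _
      (LinearMap.mem_range_self _ _)
  have hperp' : ∀ x c, M'.form (Φ' x) (g' c) = 0 := fun x c =>
    (hg'.le (LinearMap.mem_range_self g' c) : g' c ∈ M'.form.orthogonal U') _
      (LinearMap.mem_range_self _ _)
  obtain ⟨L, hL, hLΦ⟩ := exists_isometry_of_surjective M M' (Φ.coprod g) (Φ'.coprod g')
    (by
      rw [← LinearMap.range_eq_top, LinearMap.range_coprod, hg]
      exact hc.sup_eq_top)
    (by
      rw [← LinearMap.range_eq_top, LinearMap.range_coprod, hg']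
      exact hc'.sup_eq_top)
    (by
      rintro ⟨x, c⟩ ⟨y, d⟩
      simp only [LinearMap.coprod_apply, map_add, LinearMap.add_apply, h, hgg, hgg', hperp, hperp',
        M.form_symm (g c) (Φ y), M'.form_symm (g' c) (Φ' y)])
  have hLw : ∀ w, L (Φ w) = Φ' w := fun w => by simpa using hLΦ (w, 0)
  exact ⟨L, hL, fun x hx => M.mem_cone_of_isometry M' L.toLinearMap hL hw hww
    (by rw [LinearEquiv.coe_coe, hLw]; exact hw') hx, hLw⟩

/-- A negative definite subspace is orthogonal to some future directed unit timelike vector. -/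
theorem exists_timelike_perp (M : FlatSpacetime V) (T : Submodule ℝ V)
    (hT : ∀ x ∈ T, x ≠ 0 → M.form x x < 0) :
    ∃ e ∈ M.cone, M.form e e = 1 ∧ ∀ x ∈ T, M.form e x = 0 := by
  have hc : IsCompl T (M.form.orthogonal T) := by
    rw [LinearMap.BilinForm.isCompl_orthogonal_iff_disjoint M.form_isRefl, Submodule.disjoint_def]
    intro v hv hv'
    by_contra hne
    exact (hT v hv hne).ne (hv' v hv)
  obtain ⟨e₀, he₀, -, -⟩ := M.lorentzian
  obtain ⟨t, ht, e, he, hte⟩ := Submodule.mem_sup.1 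
    (by rw [hc.sup_eq_top]; trivial : e₀ ∈ T ⊔ M.form.orthogonal T)
  -- The timelike `e₀` is the orthogonal sum of `t`, with `ℓ(t, t) ≤ 0`, and `e`.
  have hpos : 0 < M.form e e := by
    have h1 : M.form t e = 0 := he t ht
    have h2 : M.form t t ≤ 0 := by
      by_cases h : t = 0
      · simp [h]
      · exact (hT t ht h).le
    rw [← hte] at he₀
    simp only [map_add, LinearMap.add_apply, h1, M.form_symm e t] at he₀
    linarith
  have hr := Real.sqrt_pos.2 hpos
  have hrr := Real.mul_self_sqrt hpos.le
  set r := Real.sqrt (M.form e e) with hrdef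
  have hunit : M.form (r⁻¹ • e) (r⁻¹ • e) = 1 := by
    simp only [map_smul, LinearMap.smul_apply, smul_eq_mul, ← hrr]
    field_simp
  have hperp : ∀ x ∈ T, M.form (r⁻¹ • e) x = 0 := fun x hx => by
    rw [M.form_symm, map_smul, (he x hx : M.form x e = 0), smul_zero]
  rcases M.mem_cone_or_neg_mem (v := r⁻¹ • e) (by rw [hunit]; norm_num) with h | h
  · exact ⟨_, h, hunit, hperp⟩
  · refine ⟨_, h, ?_, fun x hx => ?_⟩
    · rw [map_neg, map_neg, LinearMap.neg_apply, neg_neg, hunit]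
    · rw [map_neg, LinearMap.neg_apply, hperp x hx, neg_zero]

end FlatSpacetime

namespace FlatSpacetime

variable {V : Type*} [NormedAddCommGroup V] [NormedSpace ℝ V] [FiniteDimensional ℝ V]
variable {V' : Type*} [NormedAddCommGroup V'] [NormedSpace ℝ V'] [FiniteDimensional ℝ V']

namespace Realization

variable {M : FlatSpacetime V} {M' : FlatSpacetime V'}

/-! ### The geometry of a realization -/

theorem isMainFrame (D : M.Realization) (ha : D.a ≠ 0) : M.IsMainFrame D.v₀ D.v₁ D.T D.a :=
  D.frame.resolve_right fun h => ha h.1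

/-- The space `T + a T` is negative definite. -/
theorem form_neg (D : M.Realization) {w : V} (hw : w ∈ D.T ⊔ LinearMap.range D.a) (hne : w ≠ 0) :
    M.form w w < 0 := by
  obtain ⟨x, hx, y, hy, rfl⟩ := Submodule.mem_sup.1 hw
  obtain ⟨y, rfl⟩ := hy
  rcases D.frame with ⟨-, -, h0, h1, h01, hT, ha⟩ | ⟨ha, hT⟩
  · refine M.form_neg_of_perp h0 h1 h01 ?_ ?_ hne
    · rw [map_add, (hT ⟨x, hx⟩).1, (ha y).1, add_zero]
    · rw [map_add, (hT ⟨x, hx⟩).2, (ha y).2, add_zero]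
  · rw [ha] at hne ⊢
    simp only [LinearMap.zero_apply, add_zero] at hne ⊢
    by_contra! h
    rcases M.mem_cone_or_neg_mem h with h | h
    · exact hne (hT x hx h)
    · exact hne (neg_eq_zero.1 (hT _ (D.T.neg_mem hx) h))

theorem form_a_self_eq_zero (D : M.Realization) {x : D.T} (h : M.form (D.a x) (D.a x) = 0) :
    D.a x = 0 := by
  by_contra hne
  exact (D.form_neg (Submodule.mem_sup_right (LinearMap.mem_range_self _ _)) hne).ne h

/-- The symmetry of `a` cancels the Heisenberg cocycle. -/
theorem act_act (D : M.Realization) (x y : D.T) (v : V) :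
    M.act D.v₀ D.a x (M.act D.v₀ D.a y v) = M.act D.v₀ D.a (x + y) v := by
  rcases D.frame with ⟨-, -, h0, h1, h01, hT, ha⟩ | ⟨ha, hT⟩
  · rw [act_eq_actVec, act_eq_actVec, act_eq_actVec,
      M.actVec_actVec h0 (ha x).1 (ha y).1 (hT y).1, D.a_symm x y, M.form_symm x (D.a y),
      map_add, Submodule.coe_add]
    simp
  · simp only [act, ha]
    simp only [LinearMap.zero_apply, map_zero, smul_zero, mul_zero, add_zero,
      sub_zero, zero_smul, Submodule.coe_add]
    abel

theorem act_zero (D : M.Realization) (v : V) : M.act D.v₀ D.a 0 v = v := by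
  simp [act]

theorem act_injective (D : M.Realization) {x y : D.T}
    (h : ∀ v, M.act D.v₀ D.a x v = M.act D.v₀ D.a y v) : x = y := by
  have h := h 0
  simp only [act, map_zero, zero_smul, mul_zero, zero_mul, add_zero, zero_add, sub_zero] at h
  rcases D.frame with ⟨-, -, h0, h1, h01, hT, ha⟩ | ⟨ha, hT⟩
  · have h10 := M.form_symm D.v₁ D.v₀
    have := congrArg (M.form D.v₁) h
    simp only [map_sub, map_smul, (hT x).2, (hT y).2, h10, h01, smul_eq_mul, zero_sub,
      mul_one, neg_inj] at this
    rw [this] at h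
    exact Subtype.ext (sub_left_injective h)
  · rw [ha] at h
    exact Subtype.ext (by simpa using h)

/-- The lattice in `T` that parametrizes the group. -/
def lattice (D : M.Realization) : AddSubgroup D.T where
  carrier := {x | ∃ z : Fin D.m → ℤ, x = ∑ i, (z i : ℝ) • D.ι i}
  zero_mem' := ⟨0, by simp⟩
  add_mem' := by
    rintro _ _ ⟨z, rfl⟩ ⟨z', rfl⟩
    exact ⟨z + z', by simp [add_smul, Finset.sum_add_distrib]⟩
  neg_mem' := by
    rintro _ ⟨z, rfl⟩
    exact ⟨-z, by simp⟩

theorem mem_lattice (D : M.Realization) {x : D.T} :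
    x ∈ D.lattice ↔ ∃ z : Fin D.m → ℤ, x = ∑ i, (z i : ℝ) • D.ι i := Iff.rfl

theorem basis_mem_lattice (D : M.Realization) (i : Fin D.m) : D.ι i ∈ D.lattice :=
  ⟨Pi.single i 1, by simp [Pi.single_apply]⟩

theorem mem_group_iff (D : M.Realization) {γ : V ≃ᵃ[ℝ] V} :
    γ ∈ M.group ↔ ∃ x ∈ D.lattice, ∀ v, γ (D.origin + v) = D.origin + M.act D.v₀ D.a x v := by
  rw [D.mem_group]
  constructor
  · rintro ⟨z, hz⟩; exact ⟨_, ⟨z, rfl⟩, hz⟩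
  · rintro ⟨_, ⟨z, rfl⟩, hz⟩; exact ⟨z, hz⟩

/-- Every element of the lattice is the parameter of an element of the group. -/
theorem exists_mem_group (D : M.Realization) {x : D.T} (hx : x ∈ D.lattice) :
    ∃ γ ∈ M.group, ∀ v, γ (D.origin + v) = D.origin + M.act D.v₀ D.a x v := by
  have hbij : ∀ v, M.act D.v₀ D.a (-x) (M.act D.v₀ D.a x v) = v := fun v => by
    rw [D.act_act, neg_add_cancel, D.act_zero]
  have hbij' : ∀ v, M.act D.v₀ D.a x (M.act D.v₀ D.a (-x) v) = v := fun v => by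
    rw [D.act_act, add_neg_cancel, D.act_zero]
  -- The linear part of `γ_x`; it is injective because `γ_{-x}` inverts `γ_x`.
  set f : V →ₗ[ℝ] V := LinearMap.id + (M.form D.v₀).smulRight (D.a x)
    - (M.form (D.a x) + (1 / 2 * M.form (D.a x) (D.a x)) • M.form D.v₀).smulRight D.v₀ with hf
  set c : V := (x : V) - (1 / 2 * M.form (D.a x) x) • D.v₀ with hc
  have hfc : ∀ v, M.act D.v₀ D.a x v = f v + c := fun v => by
    simp only [act, hf, hc, LinearMap.sub_apply, LinearMap.add_apply, LinearMap.id_apply,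
      LinearMap.smulRight_apply, LinearMap.smul_apply, smul_eq_mul]
    module
  have hinj : Function.Injective f := by
    intro v w h
    rw [← hbij v, ← hbij w, hfc v, hfc w, h]
  let e : V ≃ₗ[ℝ] V := LinearEquiv.ofInjectiveEndo f hinj
  have hγ : ∀ v, ((AffineEquiv.constVAdd ℝ V (-D.origin)).trans (e.toAffineEquiv.trans
      (AffineEquiv.constVAdd ℝ V (D.origin + c)))) v = D.origin + c + f (-D.origin + v) :=
    fun v => rfl
  refine ⟨(AffineEquiv.constVAdd ℝ V (-D.origin)).trans (e.toAffineEquiv.trans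
      (AffineEquiv.constVAdd ℝ V (D.origin + c))), D.mem_group_iff.2 ⟨x, hx, fun v => ?_⟩,
      fun v => ?_⟩ <;>
  · rw [hγ, hfc, neg_add_cancel_left]
    abel

theorem charPoly_apply (D : M.Realization) (s : ℝ) (i j : Fin D.m) :
    D.charPoly s i j = - M.form ((D.ι i : V) + s • D.a (D.ι i)) ((D.ι j : V) + s • D.a (D.ι j)) := by
  simp only [charPoly, coeffA, coeffB, coeffC, Matrix.add_apply, Matrix.smul_apply,
    Matrix.of_apply, map_add, map_smul, LinearMap.add_apply, LinearMap.smul_apply, smul_eq_mul,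
    ← D.a_symm (D.ι i) (D.ι j)]
  ring

/-- A linear isomorphism of the spaces `T` that relates the two realizations. -/
structure IsEquivalence (D : M.Realization) (D' : M'.Realization) (E : D.T ≃ₗ[ℝ] D'.T)
    (α β : ℝ) : Prop where
  pos : 0 < α
  lattice : ∀ x, E x ∈ D'.lattice ↔ x ∈ D.lattice
  form : ∀ (s : ℝ) (x y : D.T),
    M'.form ((E x : V') + (α * s + β) • D'.a (E x)) ((E y : V') + (α * s + β) • D'.a (E y))
      = M.form ((x : V) + s • D.a x) ((y : V) + s • D.a y)

/-! ### Isometries extending an equivalence -/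

namespace IsEquivalence

variable {D : M.Realization} {D' : M'.Realization} {E : D.T ≃ₗ[ℝ] D'.T} {α β : ℝ}

/-- Both sides are quadratic in `s`; the values at `0, 1, -1` separate the coefficients. -/
theorem form_coeffs (h : D.IsEquivalence D' E α β) (x y : D.T) :
    M'.form ((E x : V') + β • D'.a (E x)) ((E y : V') + β • D'.a (E y)) = M.form x y ∧
    M'.form (α • D'.a (E x)) ((E y : V') + β • D'.a (E y)) = M.form (D.a x) y ∧
    M'.form (α • D'.a (E x)) (α • D'.a (E y)) = M.form (D.a x) (D.a y) := by
  have e0 := h.form 0 x y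
  have e1 := h.form 1 x y
  have e2 := h.form (-1) x y
  have s1 := D.a_symm x y
  have s2 := D'.a_symm (E x) (E y)
  simp only [map_add, map_smul, LinearMap.add_apply, LinearMap.smul_apply, smul_eq_mul,
    ← s1, ← s2] at e0 e1 e2 ⊢
  refine ⟨?_, ?_, ?_⟩
  · linear_combination e0
  · linear_combination (1 / 4) * e1 - (1 / 4) * e2
  · linear_combination (1 / 2) * e1 + (1 / 2) * e2 - e0

theorem a_eq_zero_iff (h : D.IsEquivalence D' E α β) (x : D.T) : D'.a (E x) = 0 ↔ D.a x = 0 := by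
  have := (h.form_coeffs x x).2.2
  constructor
  · intro h0
    refine D.form_a_self_eq_zero ?_
    rw [← this, h0]; simp
  · intro h0
    rw [h0] at this
    refine D'.form_a_self_eq_zero ?_
    have hα := h.pos.ne'
    simpa [hα] using this

theorem a_ne_zero (h : D.IsEquivalence D' E α β) (ha : D.a ≠ 0) : D'.a ≠ 0 := by
  contrapose! ha
  ext x
  exact (h.a_eq_zero_iff x).1 (by rw [ha]; rfl)

theorem a_eq_zero (h : D.IsEquivalence D' E α β) (ha : D.a = 0) : D'.a = 0 := by
  ext x
  have := (h.a_eq_zero_iff (E.symm x)).2 (by rw [ha]; rfl)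
  simpa using this

theorem form_add_add (M : FlatSpacetime V) (u w u' w' : V) : M.form (u + w) (u' + w')
    = M.form u u' + M.form w u' + (M.form u w' + M.form w w') := by
  simp only [map_add, LinearMap.add_apply]

theorem form_frame {M : FlatSpacetime V} {v₀ v₁ w w' : V} (h0 : M.form v₀ v₀ = 0)
    (h1 : M.form v₁ v₁ = 0) (h01 : M.form v₀ v₁ = 1) (hw0 : M.form v₀ w = 0)
    (hw1 : M.form v₁ w = 0) (hw0' : M.form v₀ w' = 0) (hw1' : M.form v₁ w' = 0) (p q p' q' : ℝ) :
    M.form (p • v₀ + q • v₁ + w) (p' • v₀ + q' • v₁ + w') = p * q' + q * p' + M.form w w' := by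
  have hs := M.form_symm
  simp only [map_add, map_smul, LinearMap.add_apply, LinearMap.smul_apply, smul_eq_mul, h0, h1,
    h01, hs v₁ v₀, hs w v₀, hs w v₁, hw0, hw1, hw0', hw1']
  ring

/-- An equivalence of realizations extends to an isometry of the ambient spaces. -/
theorem exists_isometry (h : D.IsEquivalence D' E α β)
    (hn : Module.finrank ℝ V = Module.finrank ℝ V') :
    ∃ L : V ≃ₗ[ℝ] V', (∀ x y, M'.form (L x) (L y) = M.form x y) ∧
      (∀ x ∈ M.cone, L x ∈ M'.cone) ∧
      (∀ x : D.T, L x = E x + β • D'.a (E x)) ∧ (∀ x : D.T, L (D.a x) = α • D'.a (E x)) ∧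
      (D.a ≠ 0 → L D.v₀ = α⁻¹ • D'.v₀ ∧ L D.v₁ = α • D'.v₁) := by
  have hα := h.pos.ne'
  by_cases ha : D.a = 0
  · have ha' := h.a_eq_zero ha
    -- `T` alone contains no timelike vector, as `exists_isometry_of_gram` requires, so a unit one
    -- orthogonal to `T` is adjoined.
    obtain ⟨e, he, hee, heT⟩ := M.exists_timelike_perp D.T
      fun x hx hne => D.form_neg (Submodule.mem_sup_left hx) hne
    obtain ⟨e', he', hee', heT'⟩ := M'.exists_timelike_perp D'.T
      fun x hx hne => D'.form_neg (Submodule.mem_sup_left hx) hne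
    have hEE : ∀ x y : D.T, M'.form (E x) (E y) = M.form x y := fun x y => by
      have := (h.form_coeffs x y).1
      simpa [ha'] using this
    obtain ⟨L, hL, hLC, hLΦ⟩ := exists_isometry_of_gram M M' hn
      (D.T.subtype.coprod (LinearMap.toSpanSingleton ℝ V e))
      ((D'.T.subtype ∘ₗ E.toLinearMap).coprod (LinearMap.toSpanSingleton ℝ V' e'))
      (by
        rintro ⟨x, p⟩ ⟨y, q⟩
        have f1 := heT x x.2
        have f2 := heT y y.2
        have f3 := heT' (E x) (E x).2
        have f4 := heT' (E y) (E y).2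
        simp [hee, hee', f1, f2, f3, f4, M.form_symm x e, M'.form_symm (E x) e', hEE])
      (w := (0, 1)) (by simpa using he) (by simpa using he') (by simp [hee])
    refine ⟨L, hL, hLC, fun x => ?_, fun x => ?_, fun h => absurd ha h⟩
    · simpa [ha'] using hLΦ (x, 0)
    · simp [ha, ha']
  · obtain ⟨hC0, hC1, h0, h1, h01, hT, haN⟩ := D.isMainFrame ha
    obtain ⟨hC0', hC1', h0', h1', h01', hT', haN'⟩ := D'.isMainFrame (h.a_ne_zero ha)
    have hs := M.form_symm
    have hs' := M'.form_symm
    have h10 := hs D.v₁ D.v₀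
    rw [h01] at h10
    -- The factors `α⁻¹` and `α` preserve `ℓ(v₀, v₁) = 1` and the cones; the timelike vector is `v₀
    -- + v₁`.
    obtain ⟨L, hL, hLC, hLΦ⟩ := exists_isometry_of_gram M M' hn
      (((LinearMap.toSpanSingleton ℝ V D.v₀).coprod (LinearMap.toSpanSingleton ℝ V D.v₁)).coprod
        (D.T.subtype.coprod D.a))
      (((LinearMap.toSpanSingleton ℝ V' (α⁻¹ • D'.v₀)).coprod
        (LinearMap.toSpanSingleton ℝ V' (α • D'.v₁))).coprod
        (((D'.T.subtype + β • D'.a) ∘ₗ E.toLinearMap).coprod ((α • D'.a) ∘ₗ E.toLinearMap)))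
      (by
        rintro ⟨⟨p, q⟩, x, y⟩ ⟨⟨p', q'⟩, x', y'⟩
        obtain ⟨c1, -, -⟩ := h.form_coeffs x x'
        obtain ⟨-, c2, -⟩ := h.form_coeffs y x'
        obtain ⟨-, c3, -⟩ := h.form_coeffs y' x
        obtain ⟨-, -, c4⟩ := h.form_coeffs y y'
        have hT0 := fun x => (hT x).1
        have hT1 := fun x => (hT x).2
        have ha0 := fun x => (haN x).1
        have ha1 := fun x => (haN x).2
        have hT0' := fun x => (hT' x).1
        have hT1' := fun x => (hT' x).2
        have ha0' := fun x => (haN' x).1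
        have ha1' := fun x => (haN' x).2
        simp only [LinearMap.coprod_apply, LinearMap.toSpanSingleton_apply, Submodule.subtype_apply,
          LinearMap.comp_apply, LinearMap.add_apply, LinearMap.smul_apply, LinearEquiv.coe_coe,
          smul_smul]
        rw [form_frame h0 h1 h01 (by simp [hT0, ha0]) (by simp [hT1, ha1]) (by simp [hT0, ha0])
            (by simp [hT1, ha1]),
          form_frame h0' h1' h01' (by simp [hT0', ha0']) (by simp [hT1', ha1'])
            (by simp [hT0', ha0']) (by simp [hT1', ha1'])]
        have e1 : p * α⁻¹ * (q' * α) + q * α * (p' * α⁻¹) = p * q' + q * p' := by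
          field_simp
        rw [e1]
        congr 1
        have c3' := (hs' _ _).trans (c3.trans (hs _ _))
        rw [form_add_add M, form_add_add M', c1, c2, c3', c4])
      (w := ((1, 1), 0)) (by simpa using M.add_mem_cone hC0 hC1)
      (by simpa using M'.add_mem_cone (M'.smul_mem_cone hC0' (inv_nonneg.2 h.pos.le))
              (M'.smul_mem_cone hC1' h.pos.le)) (by
        simp [h0, h1, h01, h10])
    refine ⟨L, hL, hLC, fun x => ?_, fun x => ?_, fun _ => ⟨?_, ?_⟩⟩
    · simpa using hLΦ (0, x, 0)
    · simpa using hLΦ (0, 0, x)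
    · simpa using hLΦ ((1, 0), 0)
    · simpa using hLΦ ((0, 1), 0)

end IsEquivalence

end Realization

end FlatSpacetime

namespace FlatSpacetime

variable {V : Type*} [NormedAddCommGroup V] [NormedSpace ℝ V] [FiniteDimensional ℝ V]
variable {V' : Type*} [NormedAddCommGroup V'] [NormedSpace ℝ V'] [FiniteDimensional ℝ V']

/-! ### Equivalences of realizations and affine isometries -/

/-- An affine isometry that preserves the cones and conjugates the groups. -/
structure IsCausalEquiv (M : FlatSpacetime V) (M' : FlatSpacetime V') (F : V ≃ᵃ[ℝ] V') :
    Prop where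
  form : ∀ x y, M'.form (F.linear x) (F.linear y) = M.form x y
  cone : ∀ x ∈ M.cone, F.linear x ∈ M'.cone
  conj : ∀ γ ∈ M.group, ∃ γ' ∈ M'.group, ∀ v, F (γ v) = γ' (F v)
  conj_symm : ∀ γ' ∈ M'.group, ∃ γ ∈ M.group, ∀ v, F (γ v) = γ' (F v)

theorem IsCausalEquiv.symm {M : FlatSpacetime V} {M' : FlatSpacetime V'} {F : V ≃ᵃ[ℝ] V'}
    (h : IsCausalEquiv M M' F) : IsCausalEquiv M' M F.symm where
  form x y := by
    rw [← h.form]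
    change M'.form (F.linear (F.linear.symm x)) (F.linear (F.linear.symm y)) = _
    rw [LinearEquiv.apply_symm_apply, LinearEquiv.apply_symm_apply]
  cone x hx := by
    change F.linear.symm x ∈ M.cone
    have e : F.linear (F.linear.symm x) = x := F.linear.apply_symm_apply x
    have h0 : 0 ≤ M.form (F.linear.symm x) (F.linear.symm x) := by
      rw [← h.form, e]; exact M'.form_self_nonneg hx
    rcases M.mem_cone_or_neg_mem h0 with h1 | h1
    · exact h1
    · have h2 := h.cone _ h1
      rw [map_neg, e] at h2
      rw [M'.eq_zero_of_mem_cone_of_neg_mem hx h2, map_zero]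
      exact M.zero_mem_cone
  conj γ' hγ' := by
    obtain ⟨γ, hγ, e⟩ := h.conj_symm γ' hγ'
    refine ⟨γ, hγ, fun v => F.injective ?_⟩
    rw [e, F.apply_symm_apply, F.apply_symm_apply]
  conj_symm γ hγ := by
    obtain ⟨γ', hγ', e⟩ := h.conj γ hγ
    refine ⟨γ', hγ', fun v => F.injective ?_⟩
    rw [e, F.apply_symm_apply, F.apply_symm_apply]

namespace Realization

variable {M : FlatSpacetime V} {M' : FlatSpacetime V'}

/-- By the modular law `T + a T` is the direct sum of `T` and `R`, so `r` can be read off from the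
dimension of `T + a T`. -/
theorem finrank_R (D : M.Realization) : Module.finrank ℝ D.T + Module.finrank ℝ D.R
    = Module.finrank ℝ (D.T ⊔ LinearMap.range D.a : Submodule ℝ V) := by
  have hdisj : Disjoint D.T (M.form.orthogonal D.T) := by
    rw [Submodule.disjoint_def]
    intro v hv hv'
    by_contra hne
    exact (D.form_neg (Submodule.mem_sup_left hv) hne).ne (hv' v hv)
  have hc : IsCompl D.T (M.form.orthogonal D.T) :=
    (LinearMap.BilinForm.isCompl_orthogonal_iff_disjoint M.form_isRefl).2 hdisj
  have hsup : D.T ⊔ D.R = D.T ⊔ LinearMap.range D.a := by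
    rw [R, sup_comm (LinearMap.range D.a), inf_comm, ← sup_inf_assoc_of_le _ le_sup_left,
      hc.sup_eq_top, top_inf_eq]
  have hinf : D.T ⊓ D.R = ⊥ := (hdisj.mono_right inf_le_right).eq_bot
  have := Submodule.finrank_sup_add_finrank_inf_eq D.T D.R
  rw [hsup, hinf, finrank_bot] at this
  omega

namespace IsEquivalence

variable {D : M.Realization} {D' : M'.Realization} {E : D.T ≃ₗ[ℝ] D'.T} {α β : ℝ}

/-- The shift `c = β v₁'` turns `l₀'(L v) = α l₀(v)` into `α l₀(v) + β`, matching the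
reparametrization of `s`. -/
theorem exists_intertwining (h : D.IsEquivalence D' E α β)
    (hn : Module.finrank ℝ V = Module.finrank ℝ V') :
    ∃ (L : V ≃ₗ[ℝ] V') (c : V'), (∀ x y, M'.form (L x) (L y) = M.form x y) ∧
      (∀ x ∈ M.cone, L x ∈ M'.cone) ∧
      ∀ (x : D.T) (v : V), L (M.act D.v₀ D.a x v) + c = M'.act D'.v₀ D'.a (E x) (L v + c) := by
  obtain ⟨L, hL, hLC, hx, hax, hv⟩ := h.exists_isometry hn
  have hα := h.pos.ne'
  by_cases ha : D.a = 0
  · have ha' := h.a_eq_zero ha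
    refine ⟨L, 0, hL, hLC, fun x v => ?_⟩
    simp [act, ha, ha', hx]
  · obtain ⟨hv0, hv1⟩ := hv ha
    obtain ⟨-, -, h0, h1, h01, hT, haN⟩ := D.isMainFrame ha
    obtain ⟨-, -, h0', h1', h01', hT', haN'⟩ := D'.isMainFrame (h.a_ne_zero ha)
    refine ⟨L, β • D'.v₁, hL, hLC, fun x v => ?_⟩
    have e0 : M'.form D'.v₀ (L v) = α * M.form D.v₀ v := by
      have := hL D.v₀ v
      rw [hv0, map_smul, LinearMap.smul_apply, smul_eq_mul] at this
      rw [← this, mul_inv_cancel_left₀ hα]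
    have e1 : M.form (D.a x) v = α * M'.form (D'.a (E x)) (L v) := by
      rw [← hL, hax]; simp
    have e2 : M.form (D.a x) (D.a x) = α * (α * M'.form (D'.a (E x)) (D'.a (E x))) := by
      rw [← hL, hax]; simp
    have e3 : M.form (D.a x) x
        = α * (M'.form (D'.a (E x)) (E x) + β * M'.form (D'.a (E x)) (D'.a (E x))) := by
      rw [← hL, hax, hx]; simp
    have e4 : M'.form (D'.a (E x)) D'.v₁ = 0 := by rw [M'.form_symm]; exact (haN' _).2
    simp only [act, map_add, map_sub, map_smul, smul_eq_mul, e0, e1, e2, e3, e4, h01', hv0, hx,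
      hax]
    match_scalars <;> field_simp <;> ring

theorem exists_causalEquiv (h : D.IsEquivalence D' E α β)
    (hn : Module.finrank ℝ V = Module.finrank ℝ V') :
    ∃ F : V ≃ᵃ[ℝ] V', IsCausalEquiv M M' F := by
  obtain ⟨L, c, hL, hLC, hint⟩ := h.exists_intertwining hn
  set F : V ≃ᵃ[ℝ] V' := (AffineEquiv.constVAdd ℝ V (-D.origin)).trans (L.toAffineEquiv.trans
      (AffineEquiv.constVAdd ℝ V' (D'.origin + c))) with hF
  have hFv : ∀ w, F (D.origin + w) = D'.origin + (L w + c) := fun w => by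
    have : F (D.origin + w) = D'.origin + c + L (-D.origin + (D.origin + w)) := rfl
    rw [this, neg_add_cancel_left]
    abel
  have key : ∀ x ∈ D.lattice, ∀ γ : V ≃ᵃ[ℝ] V, ∀ γ' : V' ≃ᵃ[ℝ] V',
      (∀ v, γ (D.origin + v) = D.origin + M.act D.v₀ D.a x v) →
      (∀ v, γ' (D'.origin + v) = D'.origin + M'.act D'.v₀ D'.a (E x) v) →
      ∀ v, F (γ v) = γ' (F v) := by
    intro x _ γ γ' hγ hγ' v
    rw [← add_sub_cancel D.origin v, hγ, hFv, hFv, hγ', hint]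
  refine ⟨F, hL, hLC, fun γ hγ => ?_, fun γ' hγ' => ?_⟩
  · obtain ⟨x, hx, e⟩ := D.mem_group_iff.1 hγ
    obtain ⟨γ', hγ', e'⟩ := D'.exists_mem_group ((h.lattice x).2 hx)
    exact ⟨γ', hγ', key x hx γ γ' e e'⟩
  · obtain ⟨x', hx', e'⟩ := D'.mem_group_iff.1 hγ'
    have hx : E.symm x' ∈ D.lattice := by
      rw [← h.lattice, E.apply_symm_apply]; exact hx'
    obtain ⟨γ, hγ, e⟩ := D.exists_mem_group hx
    exact ⟨γ, hγ, key _ hx γ γ' e (by rwa [E.apply_symm_apply])⟩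

/-- The isometry maps `T` onto `(1 + β a') T'`, in general not onto `T'`, but it does map `a T` onto
`a' T'` and `T + a T` onto `T' + a' T'`, which suffices for `r` and `k`. -/
theorem signature_eq (h : D.IsEquivalence D' E α β)
    (hn : Module.finrank ℝ V = Module.finrank ℝ V') : D.signature = D'.signature := by
  obtain ⟨L, hL, -, hx, hax, -⟩ := h.exists_isometry hn
  have hα := h.pos.ne'
  have hT : Module.finrank ℝ D.T = Module.finrank ℝ D'.T := E.finrank_eq
  have hrange : (LinearMap.range D.a).map (L : V →ₗ[ℝ] V') = LinearMap.range D'.a := by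
    ext w
    constructor
    · rintro ⟨_, ⟨x, rfl⟩, rfl⟩
      exact ⟨α • E x, by rw [map_smul]; exact (hax x).symm⟩
    · rintro ⟨y, rfl⟩
      refine ⟨_, ⟨α⁻¹ • E.symm y, rfl⟩, ?_⟩
      change L (D.a (α⁻¹ • E.symm y)) = _
      rw [hax, map_smul, map_smul, smul_smul, mul_inv_cancel₀ hα, one_smul, E.apply_symm_apply]
  have hsup : (D.T ⊔ LinearMap.range D.a).map (L : V →ₗ[ℝ] V') = D'.T ⊔ LinearMap.range D'.a := by
    rw [Submodule.map_sup, hrange]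
    apply le_antisymm
    · refine sup_le ?_ le_sup_right
      rintro _ ⟨x, hxT, rfl⟩
      have := hx ⟨x, hxT⟩
      change L x ∈ _
      rw [this]
      exact add_mem (Submodule.mem_sup_left (E _).2)
        (Submodule.mem_sup_right (Submodule.smul_mem _ _ (LinearMap.mem_range_self _ _)))
    · refine sup_le ?_ le_sup_right
      intro y hy
      have := hx (E.symm ⟨y, hy⟩)
      rw [E.apply_symm_apply] at this
      rw [← add_sub_cancel_right y (β • D'.a ⟨y, hy⟩)]
      refine sub_mem (Submodule.mem_sup_left ⟨_, (E.symm ⟨y, hy⟩).2, this⟩)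
        (Submodule.mem_sup_right (Submodule.smul_mem _ _ (LinearMap.mem_range_self _ _)))
  have hfr : Module.finrank ℝ (LinearMap.range D.a) = Module.finrank ℝ (LinearMap.range D'.a) := by
    rw [← hrange]; exact (LinearEquiv.finrank_map_eq L _).symm
  have hfs : Module.finrank ℝ (D.T ⊔ LinearMap.range D.a : Submodule ℝ V)
      = Module.finrank ℝ (D'.T ⊔ LinearMap.range D'.a : Submodule ℝ V') := by
    rw [← hsup]; exact (LinearEquiv.finrank_map_eq L _).symm
  have hk := LinearMap.finrank_range_add_finrank_ker D.a
  have hk' := LinearMap.finrank_range_add_finrank_ker D'.a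
  have hR := D.finrank_R
  have hR' := D'.finrank_R
  simp only [signature, Prod.mk.injEq]
  omega

end IsEquivalence

/-- The form `ℓ((1 + s a) x, (1 + s a) y)` on `T`. -/
def gram (D : M.Realization) (s : ℝ) : LinearMap.BilinForm ℝ D.T :=
  M.form.compl₁₂ (D.T.subtype + s • D.a) (D.T.subtype + s • D.a)

theorem gram_apply (D : M.Realization) (s : ℝ) (x y : D.T) :
    D.gram s x y = M.form ((x : V) + s • D.a x) ((y : V) + s • D.a y) := rfl

theorem gram_symm (D : M.Realization) (s : ℝ) (x y : D.T) : D.gram s x y = D.gram s y x :=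
  M.form_symm _ _

theorem charPoly_eq_gram (D : M.Realization) (s : ℝ) (i j : Fin D.m) :
    D.charPoly s i j = - D.gram s (D.ι i) (D.ι j) := D.charPoly_apply s i j

theorem q_eq_gram (D : M.Realization) (v : V) (x : D.T) :
    D.q v x = - D.gram (M.form D.v₀ v) x x := by
  rw [q_eq_form, gram_apply]
  simp only [map_add, map_smul, LinearMap.add_apply, LinearMap.smul_apply, smul_eq_mul,
    M.form_symm (x : V) (D.a x)]
  ring

theorem sum_zsmul_mem (D : M.Realization) (G : AddSubgroup D.T) (hG : ∀ i, D.ι i ∈ G) {x : D.T}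
    (hx : x ∈ D.lattice) : x ∈ G := by
  obtain ⟨z, rfl⟩ := hx
  refine sum_mem fun i _ => ?_
  rw [Int.cast_smul_eq_zsmul]
  exact G.zsmul_mem (hG i) _

/-- The congruence of characteristic polynomials in terms of the forms on `T` and `T'`. -/
theorem congruence_apply (D : M.Realization) (D' : M'.Realization) (h : D.m = D'.m)
    (X : Matrix (Fin D.m) (Fin D.m) ℝ) (t : ℝ) (i j : Fin D.m) :
    (Xᵀ * (D'.charPoly t).submatrix (Fin.cast h) (Fin.cast h) * X) i j
      = - D'.gram t (∑ k, X k i • D'.ι (Fin.cast h k)) (∑ k, X k j • D'.ι (Fin.cast h k)) := by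
  simp only [Matrix.mul_apply, Matrix.transpose_apply, Matrix.submatrix_apply, charPoly_eq_gram,
    map_sum, map_smul, LinearMap.sum_apply, LinearMap.smul_apply, smul_eq_mul, Finset.sum_mul,
    ← Finset.sum_neg_distrib]
  refine Finset.sum_congr rfl fun k _ => ?_
  rw [Finset.mul_sum, ← Finset.sum_neg_distrib]
  refine Finset.sum_congr rfl fun l _ => ?_
  ring

/-- An integral matrix maps lattice to lattice. -/
theorem toLin_mem_lattice (D : M.Realization) (D' : M'.Realization) (h : D.m = D'.m)
    (X : Matrix (Fin D.m) (Fin D.m) ℤ) {E : D.T →ₗ[ℝ] D'.T}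
    (hE : ∀ j, E (D.ι j) = ∑ k, (X k j : ℝ) • D'.ι (Fin.cast h k)) {x : D.T}
    (hx : x ∈ D.lattice) : E x ∈ D'.lattice := by
  refine D.sum_zsmul_mem (D'.lattice.comap E.toAddMonoidHom) (fun j => ?_) hx
  change E (D.ι j) ∈ D'.lattice
  rw [hE]
  refine sum_mem fun k _ => ?_
  rw [Int.cast_smul_eq_zsmul]
  exact D'.lattice.zsmul_mem (D'.basis_mem_lattice _) _

/-- `E` has matrix `X` in the two lattice bases; integrality of `X` and `X⁻¹` matches the lattices,
and the congruence matches the forms on the bases. -/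
theorem exists_isEquivalence_of_charPoly (D : M.Realization) (D' : M'.Realization)
    (h : D.m = D'.m) (X : Matrix.GeneralLinearGroup (Fin D.m) ℤ) {α β : ℝ} (hα : 0 < α)
    (hQ : ∀ s : ℝ, D.charPoly s =
      ((X : Matrix (Fin D.m) (Fin D.m) ℤ).map (Int.cast : ℤ → ℝ))ᵀ *
        (D'.charPoly (α * s + β)).submatrix (Fin.cast h) (Fin.cast h) *
        (X : Matrix (Fin D.m) (Fin D.m) ℤ).map (Int.cast : ℤ → ℝ)) :
    ∃ E : D.T ≃ₗ[ℝ] D'.T, D.IsEquivalence D' E α β := by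
  set b : Module.Basis (Fin D.m) ℝ D'.T := D'.ι.reindex (finCongr h).symm with hb
  have hbi : ∀ i, b i = D'.ι (Fin.cast h i) := fun i => by simp [hb]
  set Y : Matrix (Fin D.m) (Fin D.m) ℤ := X.val with hY
  set Z : Matrix (Fin D.m) (Fin D.m) ℤ := (X⁻¹).val with hZ
  have hYZ : Y * Z = 1 := by rw [hY, hZ, ← Units.val_mul, mul_inv_cancel, Units.val_one]
  have hZY : Z * Y = 1 := by rw [hY, hZ, ← Units.val_mul, inv_mul_cancel, Units.val_one]
  have hYZ' : Y.map (Int.cast : ℤ → ℝ) * Z.map (Int.cast : ℤ → ℝ) = 1 := by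
    have := congrArg (Int.castRingHom ℝ).mapMatrix hYZ
    rw [map_mul, map_one] at this
    exact this
  have hZY' : Z.map (Int.cast : ℤ → ℝ) * Y.map (Int.cast : ℤ → ℝ) = 1 := by
    have := congrArg (Int.castRingHom ℝ).mapMatrix hZY
    rw [map_mul, map_one] at this
    exact this
  set E : D.T ≃ₗ[ℝ] D'.T := LinearEquiv.ofLinearMap
    (Matrix.toLin D.ι b (Y.map (Int.cast : ℤ → ℝ))) (Matrix.toLin b D.ι (Z.map (Int.cast : ℤ → ℝ)))
    (by rw [← Matrix.toLin_mul, hYZ', Matrix.toLin_one])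
    (by rw [← Matrix.toLin_mul, hZY', Matrix.toLin_one]) with hE
  have hEι : ∀ j, E (D.ι j) = ∑ k, (Y k j : ℝ) • D'.ι (Fin.cast h k) := fun j => by
    change Matrix.toLin D.ι b _ (D.ι j) = _
    simp only [Matrix.toLin_self, hbi, Matrix.map_apply]
  have hEι' : ∀ j, E.symm (D'.ι j) = ∑ k, (Z.submatrix (Fin.cast h.symm) (Fin.cast h.symm) k j : ℝ)
      • D.ι (Fin.cast h.symm k) := fun j => by
    have e : D'.ι j = b (Fin.cast h.symm j) := by rw [hbi]; rfl
    rw [e]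
    change Matrix.toLin b D.ι _ (b (Fin.cast h.symm j)) = _
    simp only [Matrix.toLin_self, Matrix.map_apply, Matrix.submatrix_apply]
    exact (Equiv.sum_comp (finCongr h.symm) fun i => ((Z i (Fin.cast h.symm j) : ℤ) : ℝ) • D.ι i).symm
  refine ⟨E, hα, fun x => ⟨fun hx => ?_, fun hx => ?_⟩, fun s x y => ?_⟩
  · have := D'.toLin_mem_lattice D h.symm _ (E := E.symm.toLinearMap) hEι' hx
    simpa using this
  · exact D.toLin_mem_lattice D' h Y (E := E.toLinearMap) hEι hx
  · have key : (D'.gram (α * s + β)).compl₁₂ E.toLinearMap E.toLinearMap = D.gram s := by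
      refine LinearMap.ext_basis D.ι D.ι fun i j => ?_
      have h1 := congrFun (congrFun (hQ s) i) j
      rw [congruence_apply, charPoly_eq_gram, neg_inj] at h1
      rw [h1]
      simp only [LinearMap.compl₁₂_apply, LinearEquiv.coe_coe, hEι]
      rfl
    exact LinearMap.congr_fun₂ key x y

theorem IsEquivalence.exists_matrix {D : M.Realization} {D' : M'.Realization}
    {E : D.T ≃ₗ[ℝ] D'.T} {α β : ℝ} (hE : D.IsEquivalence D' E α β) :
    ∃ (h : D.m = D'.m) (X : Matrix.GeneralLinearGroup (Fin D.m) ℤ),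
      ∀ s : ℝ, D.charPoly s =
        ((X : Matrix (Fin D.m) (Fin D.m) ℤ).map (Int.cast : ℤ → ℝ))ᵀ *
          (D'.charPoly (α * s + β)).submatrix (Fin.cast h) (Fin.cast h) *
          (X : Matrix (Fin D.m) (Fin D.m) ℤ).map (Int.cast : ℤ → ℝ) := by
  have h : D.m = D'.m := by
    have h1 := Module.finrank_eq_card_basis D.ι
    have h2 := Module.finrank_eq_card_basis D'.ι
    have h3 := E.finrank_eq
    simp only [Fintype.card_fin] at h1 h2
    omega
  choose y hy using fun j => D'.mem_lattice.1 ((hE.lattice _).2 (D.basis_mem_lattice j))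
  choose z hz using fun j => D.mem_lattice.1 ((hE.lattice (E.symm (D'.ι j))).1 (by
    rw [E.apply_symm_apply]; exact D'.basis_mem_lattice j))
  set Y : Matrix (Fin D.m) (Fin D.m) ℤ := Matrix.of fun k j => y j (Fin.cast h k) with hY
  set Z : Matrix (Fin D.m) (Fin D.m) ℤ := Matrix.of fun k j => z (Fin.cast h j) k with hZ
  have hEι : ∀ j, E (D.ι j) = ∑ k, (Y k j : ℝ) • D'.ι (Fin.cast h k) := fun j => by
    rw [hy]
    exact (Equiv.sum_comp (finCongr h) fun i => ((y j i : ℤ) : ℝ) • D'.ι i).symm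
  have hEι' : ∀ j, E.symm (D'.ι (Fin.cast h j)) = ∑ k, (Z k j : ℝ) • D.ι k := fun j => hz _
  have hZY : Z * Y = 1 := by
    ext i j
    have e : D.ι j = ∑ k, ((Z * Y) k j : ℝ) • D.ι k := by
      conv_lhs => rw [← E.symm_apply_apply (D.ι j), hEι]
      simp only [map_sum, map_smul, hEι', Finset.smul_sum, smul_smul, Matrix.mul_apply,
        Int.cast_sum, Int.cast_mul, Finset.sum_smul]
      rw [Finset.sum_comm]
      refine Finset.sum_congr rfl fun k _ => Finset.sum_congr rfl fun l _ => ?_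
      rw [mul_comm]
    have e2 := congrArg (fun x => D.ι.repr x i) e
    simp only [Module.Basis.repr_self, map_sum, map_smul, Finsupp.coe_finsetSum,
      Finset.sum_apply, Finsupp.smul_apply, smul_eq_mul, Finsupp.single_apply, mul_ite, mul_one,
      mul_zero, Finset.sum_ite_eq', Finset.mem_univ, if_true] at e2
    rw [Matrix.one_apply]
    have e3 : ((Z * Y) i j : ℝ) = ((if i = j then 1 else 0 : ℤ) : ℝ) := by
      rw [← e2]
      by_cases hij : i = j
      · simp [hij]
      · simp [hij, Ne.symm hij]
    exact_mod_cast e3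
  have hYZ : Y * Z = 1 := mul_eq_one_comm.1 hZY
  refine ⟨h, ⟨Y, Z, hYZ, hZY⟩, fun s => ?_⟩
  ext i j
  rw [congruence_apply, charPoly_eq_gram, neg_inj]
  have := hE.form s (D.ι i) (D.ι j)
  rw [hEι, hEι] at this
  exact this.symm

/-! ### From affine isometries to equivalences -/

theorem exists_linear_of_causalEquiv (D : M.Realization) (D' : M'.Realization)
    {F : V ≃ᵃ[ℝ] V'} (hF : IsCausalEquiv M M' F) :
    ∃ E : D.T →ₗ[ℝ] D'.T, ∀ x ∈ D.lattice, E x ∈ D'.lattice ∧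
      ∀ v, F (D.origin + M.act D.v₀ D.a x v) - D'.origin
        = M'.act D'.v₀ D'.a (E x) (F (D.origin + v) - D'.origin) := by
  have hex : ∀ x ∈ D.lattice, ∃ x' ∈ D'.lattice,
      ∀ v, F (D.origin + M.act D.v₀ D.a x v) - D'.origin
        = M'.act D'.v₀ D'.a x' (F (D.origin + v) - D'.origin) := by
    intro x hx
    obtain ⟨γ, hγ, e⟩ := D.exists_mem_group hx
    obtain ⟨γ', hγ', e1⟩ := hF.conj γ hγ
    obtain ⟨x', hx', e'⟩ := D'.mem_group_iff.1 hγ'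
    refine ⟨x', hx', fun v => ?_⟩
    rw [← e, e1, ← add_sub_cancel D'.origin (F (D.origin + v)), e', add_sub_cancel_left,
      add_sub_cancel_left]
  choose! ψ hψ hψ' using hex
  -- Additivity of the chosen `ψ` need not be checked: `E` agrees with it on the basis, and the
  -- points where `E` intertwines the actions form a subgroup.
  set E : D.T →ₗ[ℝ] D'.T := D.ι.constr ℝ fun j => ψ (D.ι j) with hE
  let G : AddSubgroup D.T :=
    { carrier := {x | E x ∈ D'.lattice ∧
        ∀ v, F (D.origin + M.act D.v₀ D.a x v) - D'.origin
          = M'.act D'.v₀ D'.a (E x) (F (D.origin + v) - D'.origin)}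
      zero_mem' := ⟨by rw [map_zero]; exact D'.lattice.zero_mem, fun v => by
        rw [map_zero, D.act_zero, D'.act_zero]⟩
      add_mem' := by
        rintro x y ⟨hx, ex⟩ ⟨hy, ey⟩
        refine ⟨by rw [map_add]; exact D'.lattice.add_mem hx hy, fun v => ?_⟩
        rw [← D.act_act, ex, ey, D'.act_act, map_add E]
      neg_mem' := by
        rintro x ⟨hx, ex⟩
        refine ⟨by rw [map_neg]; exact D'.lattice.neg_mem hx, fun v => ?_⟩
        have := ex (M.act D.v₀ D.a (-x) v)
        rw [D.act_act, add_neg_cancel, D.act_zero] at this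
        rw [this, map_neg, D'.act_act, neg_add_cancel, D'.act_zero] }
  refine ⟨E, fun x hx => D.sum_zsmul_mem G (fun i => ?_) hx⟩
  have : E (D.ι i) = ψ (D.ι i) := by rw [hE, Module.Basis.constr_basis]
  refine ⟨?_, ?_⟩ <;> rw [this]
  · exact hψ _ (D.basis_mem_lattice i)
  · exact hψ' _ (D.basis_mem_lattice i)

/-- The linear maps obtained from `F` and `F⁻¹` are mutually inverse because `x ↦ γ_x` is injective.
-/
theorem exists_equiv_of_causalEquiv (D : M.Realization) (D' : M'.Realization)
    {F : V ≃ᵃ[ℝ] V'} (hF : IsCausalEquiv M M' F) :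
    ∃ E : D.T ≃ₗ[ℝ] D'.T, (∀ x, E x ∈ D'.lattice ↔ x ∈ D.lattice) ∧ ∀ x ∈ D.lattice,
      ∀ v, F (D.origin + M.act D.v₀ D.a x v) - D'.origin
        = M'.act D'.v₀ D'.a (E x) (F (D.origin + v) - D'.origin) := by
  obtain ⟨E, hE⟩ := D.exists_linear_of_causalEquiv D' hF
  obtain ⟨E', hE'⟩ := D'.exists_linear_of_causalEquiv D hF.symm
  have h1 : E' ∘ₗ E = LinearMap.id := D.ι.ext fun i => by
    obtain ⟨m1, e1⟩ := hE _ (D.basis_mem_lattice i)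
    obtain ⟨m2, e2⟩ := hE' _ m1
    refine D.act_injective fun v => ?_
    have h3 := e1 v
    have h4 := e2 (F (D.origin + v) - D'.origin)
    rw [← h3, add_sub_cancel, add_sub_cancel, F.symm_apply_apply, F.symm_apply_apply,
      add_sub_cancel_left, add_sub_cancel_left] at h4
    exact h4.symm
  have h2 : E ∘ₗ E' = LinearMap.id := D'.ι.ext fun i => by
    obtain ⟨m1, e1⟩ := hE' _ (D'.basis_mem_lattice i)
    obtain ⟨m2, e2⟩ := hE _ m1
    refine D'.act_injective fun v => ?_
    have h3 := e1 v
    have h4 := e2 (F.symm (D'.origin + v) - D.origin)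
    rw [← h3, add_sub_cancel, add_sub_cancel, F.apply_symm_apply, F.apply_symm_apply,
      add_sub_cancel_left, add_sub_cancel_left] at h4
    exact h4.symm
  refine ⟨LinearEquiv.ofLinearMap E E' h2 h1, fun x => ⟨fun hx => ?_, fun hx => (hE x hx).1⟩,
    fun x hx => (hE x hx).2⟩
  have := (hE' _ hx).1
  have e : E' (E x) = x := LinearMap.congr_fun h1 x
  exact e ▸ this

/-- An affine isometry relates the forms on `T` and `T'`. -/
theorem gram_of_causalEquiv (D : M.Realization) (D' : M'.Realization) {F : V ≃ᵃ[ℝ] V'}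
    (hF : IsCausalEquiv M M' F) (E : D.T ≃ₗ[ℝ] D'.T)
    (hE : ∀ x ∈ D.lattice, ∀ v, F (D.origin + M.act D.v₀ D.a x v) - D'.origin
        = M'.act D'.v₀ D'.a (E x) (F (D.origin + v) - D'.origin)) (v : V) (x y : D.T) :
    D'.gram (M'.form D'.v₀ (F (D.origin + v) - D'.origin)) (E x) (E y)
      = D.gram (M.form D.v₀ v) x y := by
  set w := F (D.origin + v) - D'.origin with hw
  have hdiag : ∀ x ∈ D.lattice, D'.gram (M'.form D'.v₀ w) (E x) (E x)
      = D.gram (M.form D.v₀ v) x x := by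
    intro x hx
    rw [← neg_inj, ← q_eq_gram, ← q_eq_gram, q, q, ← hE x hx v, neg_inj, ← hF.form]
    have : F (D.origin + M.act D.v₀ D.a x v) - D'.origin - w
        = F.linear (M.act D.v₀ D.a x v - v) := by
      have := (F : V →ᵃ[ℝ] V').linearMap_vsub (D.origin + M.act D.v₀ D.a x v) (D.origin + v)
      simp only [vsub_eq_sub, add_sub_add_left_eq_sub] at this
      rw [hw, sub_sub_sub_cancel_right]
      exact this.symm
    rw [this]
  have key : (D'.gram (M'.form D'.v₀ w)).compl₁₂ E.toLinearMap E.toLinearMap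
      = D.gram (M.form D.v₀ v) := by
    refine LinearMap.ext_basis D.ι D.ι fun i j => ?_
    have hi := D.basis_mem_lattice i
    have hj := D.basis_mem_lattice j
    have e1 := hdiag _ hi
    have e2 := hdiag _ hj
    -- Polarization, inside the lattice.
    have e3 := hdiag _ (D.lattice.add_mem hi hj)
    simp only [map_add, LinearMap.add_apply, D.gram_symm _ (D.ι j) (D.ι i),
      D'.gram_symm _ (E (D.ι j)) (E (D.ι i))] at e3
    simp only [LinearMap.compl₁₂_apply, LinearEquiv.coe_coe]
    linarith
  exact LinearMap.congr_fun₂ key x y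

/-- The second difference in `s` isolates `ℓ(a x, a x)`, and `a T` is negative definite. -/
theorem a_eq_zero_of_gram (D : M.Realization)
    (h : ∀ s x, D.gram s x x = D.gram 0 x x) : D.a = 0 := by
  ext x
  have h1 := h 1 x
  have h2 := h (-1) x
  simp only [gram_apply, map_add, map_smul, LinearMap.add_apply, LinearMap.smul_apply,
    smul_eq_mul, zero_smul, map_zero, LinearMap.zero_apply] at h1 h2
  exact D.form_a_self_eq_zero (by linarith)

theorem gram_of_a_eq_zero (D : M.Realization) (ha : D.a = 0) (s t : ℝ) : D.gram s = D.gram t := by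
  ext x y
  simp [gram_apply, ha]

theorem exists_isEquivalence_of_causalEquiv (D : M.Realization) (D' : M'.Realization)
    {F : V ≃ᵃ[ℝ] V'} (hF : IsCausalEquiv M M' F) :
    ∃ (E : D.T ≃ₗ[ℝ] D'.T) (α β : ℝ), D.IsEquivalence D' E α β := by
  obtain ⟨E, hlat, hE⟩ := D.exists_equiv_of_causalEquiv D' hF
  have hgram := D.gram_of_causalEquiv D' hF E hE
  set β := M'.form D'.v₀ (F D.origin - D'.origin) with hβ
  have ht : ∀ v, M'.form D'.v₀ (F (D.origin + v) - D'.origin)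
      = M'.form D'.v₀ (F.linear v) + β := by
    intro v
    have := F.map_vadd D.origin v
    simp only [vadd_eq_add] at this
    rw [add_comm D.origin v, this, hβ, ← map_add]
    congr 1
    abel
  simp only [ht] at hgram
  by_cases ha : D.a = 0
  -- Here the form on `T` does not depend on `s`, so `α = 1`, `β = 0` serve once the form on `T'` is
  -- constant too. This is clear for `a' = 0`; otherwise `l₀' ∘ F` attains every value `s`.
  · refine ⟨E, 1, 0, one_pos, hlat, fun s x y => ?_⟩
    rw [one_mul, add_zero]
    change D'.gram s (E x) (E y) = D.gram s x y
    by_cases ha' : D'.a = 0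
    · rw [D.gram_of_a_eq_zero ha s (M.form D.v₀ 0), ← hgram 0]
      exact LinearMap.congr_fun₂ (D'.gram_of_a_eq_zero ha' _ _) _ _
    · obtain ⟨-, -, -, -, h01', -, -⟩ := D'.isMainFrame ha'
      have := hgram (F.linear.symm ((s - β) • D'.v₁)) x y
      rw [LinearEquiv.apply_symm_apply, map_smul, h01', smul_eq_mul, mul_one, sub_add_cancel] at this
      rw [this, D.gram_of_a_eq_zero ha _ s]
  · obtain ⟨hC0, hC1, h0, h1, h01, hT, haN⟩ := D.isMainFrame ha
    -- If `l₀'` varied along `F.linear v` with `l₀(v) = 0`, the form on `T'` at any value would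
    -- equal the form on `T` at `s = 0`, making the latter constant in `s`.
    have hker : ∀ v, M.form D.v₀ v = 0 → M'.form D'.v₀ (F.linear v) = 0 := by
      intro v hv
      by_contra hne
      refine ha (D.a_eq_zero_of_gram fun s x => ?_)
      set t := M'.form D'.v₀ (F.linear (s • D.v₁)) + β with htdef
      have e1 := hgram (s • D.v₁) x x
      have e2 := hgram (((t - β) / M'.form D'.v₀ (F.linear v)) • v) x x
      rw [map_smul, map_smul, map_smul, hv, smul_eq_mul, smul_eq_mul, mul_zero,
        div_mul_cancel₀ _ hne, sub_add_cancel] at e2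
      rw [← htdef, e2, map_smul, h01, smul_eq_mul, mul_one] at e1
      exact e1.symm
    set α := M'.form D'.v₀ (F.linear D.v₁) with hα
    have hlin : ∀ v, M'.form D'.v₀ (F.linear v) = α * M.form D.v₀ v := by
      intro v
      have := hker (v - M.form D.v₀ v • D.v₁) (by simp [h01])
      rw [map_sub, map_sub, map_smul, map_smul, smul_eq_mul, sub_eq_zero] at this
      rw [this, mul_comm]
    have hform : ∀ s x y, D'.gram (α * s + β) (E x) (E y) = D.gram s x y := by
      intro s x y
      have := hgram (s • D.v₁) x y
      rwa [hlin, map_smul, h01, smul_eq_mul, mul_one] at this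
    have ha' : D'.a ≠ 0 := fun ha' => ha (D.a_eq_zero_of_gram fun s x => by
      rw [← hform, ← hform, D'.gram_of_a_eq_zero ha' _ (α * 0 + β)])
    obtain ⟨hC0', -⟩ := D'.isMainFrame ha'
    have hα0 : α ≠ 0 := fun h => ha (D.a_eq_zero_of_gram fun s x => by
      rw [← hform, ← hform, h, zero_mul, zero_mul])
    have hαpos : 0 ≤ α := M'.form_nonneg hC0' (hF.cone _ hC1)
    exact ⟨E, α, β, lt_of_le_of_ne hαpos hα0.symm, hlat, hform⟩

end Realization

end FlatSpacetime

namespace FlatSpacetime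

/-! ### Causal isometries and affine isometries -/

theorem hasFDerivAt_affineEquiv {V V' : Type*} [NormedAddCommGroup V]
    [NormedSpace ℝ V] [FiniteDimensional ℝ V] [NormedAddCommGroup V'] [NormedSpace ℝ V']
    (F : V ≃ᵃ[ℝ] V') (v : V) :
    HasFDerivAt F (LinearMap.toContinuousLinearMap (F.linear : V →ₗ[ℝ] V')) v := by
  have e : (F : V → V') = fun v =>
      LinearMap.toContinuousLinearMap (F.linear : V →ₗ[ℝ] V') v + F 0 := by
    ext v
    have := F.map_vadd 0 v
    simpa using this
  rw [e]
  exact (ContinuousLinearMap.hasFDerivAt _).add_const _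

theorem contDiff_affineEquiv {V V' : Type*} [NormedAddCommGroup V]
    [NormedSpace ℝ V] [FiniteDimensional ℝ V] [NormedAddCommGroup V'] [NormedSpace ℝ V']
    (F : V ≃ᵃ[ℝ] V') : ContDiff ℝ ∞ F := by
  have e : (F : V → V') = fun v =>
      LinearMap.toContinuousLinearMap (F.linear : V →ₗ[ℝ] V') v + F 0 := by
    ext v
    have := F.map_vadd 0 v
    simpa using this
  rw [e]
  exact (ContinuousLinearMap.contDiff _).add contDiff_const

variable {V : Type*} [NormedAddCommGroup V] [NormedSpace ℝ V] [FiniteDimensional ℝ V]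
variable {V' : Type*} [NormedAddCommGroup V'] [NormedSpace ℝ V'] [FiniteDimensional ℝ V']

theorem IsCausalEquiv.proj_eq_iff {M : FlatSpacetime V} {M' : FlatSpacetime V'} {F : V ≃ᵃ[ℝ] V'}
    (h : IsCausalEquiv M M' F) (v w : V) : M.proj v = M.proj w ↔ M'.proj (F v) = M'.proj (F w) := by
  rw [M.proj_eq_iff, M'.proj_eq_iff]
  constructor
  · rintro ⟨γ, hγ, rfl⟩
    obtain ⟨γ', hγ', e⟩ := h.conj γ hγ
    exact ⟨γ', hγ', (e v).symm⟩
  · rintro ⟨γ', hγ', e'⟩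
    obtain ⟨γ, hγ, e⟩ := h.conj_symm γ' hγ'
    exact ⟨γ, hγ, F.injective (by rw [e, e'])⟩

theorem IsCausalEquiv.isLocalCausalIsometry {M : FlatSpacetime V} {M' : FlatSpacetime V'}
    {F : V ≃ᵃ[ℝ] V'} (h : IsCausalEquiv M M' F) {f : M.Point → M'.Point}
    (hf : ∀ v, f (M.proj v) = M'.proj (F v)) : IsLocalCausalIsometry M M' f := by
  refine fun v => ⟨Set.univ, F, isOpen_univ, trivial, (contDiff_affineEquiv F).contDiffOn,
    fun u _ => hf u, fun u _ => ?_⟩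
  rw [(hasFDerivAt_affineEquiv F u).fderiv]
  exact ⟨h.form, h.cone⟩

theorem IsCausalEquiv.causallyIsometric {M : FlatSpacetime V} {M' : FlatSpacetime V'}
    {F : V ≃ᵃ[ℝ] V'} (h : IsCausalEquiv M M' F) : M.CausallyIsometric M' := by
  have hrel : ∀ v w, M.orbitSetoid v w ↔ M'.orbitSetoid (F.toEquiv v) (F.toEquiv w) := fun v w =>
    M.proj_eq_iff.symm.trans ((h.proj_eq_iff v w).trans M'.proj_eq_iff)
  let e : M.Point ≃ M'.Point := Quotient.congr F.toEquiv hrel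
  have he : ∀ v, e (M.proj v) = M'.proj (F v) := fun v => rfl
  have he' : ∀ v, e.symm (M'.proj v) = M.proj (F.symm v) := fun v => by
    rw [Equiv.symm_apply_eq, he, F.apply_symm_apply]
  let f : M.Point ≃ₜ M'.Point :=
    { toEquiv := e
      continuous_toFun := by
        refine continuous_quot_lift _ ?_
        exact M'.continuous_proj.comp (contDiff_affineEquiv F).continuous
      continuous_invFun := by
        have hq : Topology.IsQuotientMap M'.proj := isQuotientMap_quotient_mk'
        rw [hq.continuous_iff]
        have : e.symm ∘ M'.proj = M.proj ∘ F.symm := funext he'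
        exact this ▸ M.continuous_proj.comp (contDiff_affineEquiv F.symm).continuous }
  exact ⟨f, h.isLocalCausalIsometry he, h.symm.isLocalCausalIsometry he'⟩

/-! ### Lifting causal isometries to affine isometries -/

theorem isCoveringMap_proj (M : FlatSpacetime V) : IsCoveringMap M.proj := by
  let _ : MulAction M.group V :=
    { smul := fun γ v => γ.1 v
      one_smul := fun _ => rfl
      mul_smul := fun _ _ _ => rfl }
  have hsmul : ∀ (γ : M.group) (v : V), γ • v = γ.1 v := fun _ _ => rfl
  have : ContinuousConstSMul M.group V :=
    ⟨fun γ => (contDiff_affineEquiv γ.1).continuous⟩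
  have : ProperlyDiscontinuousSMul M.group V :=
    { finite_disjoint_inter_image := by
        intro K L hK hL
        have hfin := M.proper (K ∪ L) (hK.union hL)
        refine Set.Finite.of_finite_image (f := Subtype.val) (hfin.subset ?_)
          Subtype.val_injective.injOn
        rintro _ ⟨γ, hγ, rfl⟩
        obtain ⟨_, ⟨x, hx, rfl⟩, hy⟩ := hγ
        exact ⟨γ.2, _, ⟨x, Or.inl hx, rfl⟩, Or.inr hy⟩ }
  have : IsCancelSMul M.group V := isCancelSMul_iff_eq_one_of_smul_eq.mpr
    fun γ v h => Subtype.ext (M.free γ.1 γ.2 v h)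
  have hq : Topology.IsQuotientMap M.proj := isQuotientMap_quotient_mk'
  refine (hq.isQuotientCoveringMap_of_properlyDiscontinuousSMul (G := M.group) ?_).isCoveringMap
  intro v w
  rw [eq_comm, M.proj_eq_iff]
  constructor
  · rintro ⟨γ, hγ, h⟩; exact ⟨⟨γ, hγ⟩, h⟩
  · rintro ⟨⟨γ, hγ⟩, h⟩; exact ⟨γ, hγ, h⟩

/-- The form as a continuous bilinear mapping. -/
def formL (M : FlatSpacetime V) : V →L[ℝ] V →L[ℝ] ℝ :=
  LinearMap.toContinuousLinearMap
    ((LinearMap.toContinuousLinearMap : (V →ₗ[ℝ] ℝ) ≃ₗ[ℝ] (V →L[ℝ] ℝ)).toLinearMap ∘ₗ M.form)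

theorem injective_of_isometry (M : FlatSpacetime V) (M' : FlatSpacetime V') (L : V →ₗ[ℝ] V')
    (hL : ∀ x y, M'.form (L x) (L y) = M.form x y) : Function.Injective L := by
  rw [injective_iff_map_eq_zero]
  intro x hx
  refine M.eq_zero_of_form_eq_zero fun y => ?_
  rw [← hL, hx]; simp

/-- A smooth isometry of flat spaces has a constant differential. -/
theorem fderiv_eq_of_isometry (M : FlatSpacetime V) (M' : FlatSpacetime V')
    (hn : Module.finrank ℝ V = Module.finrank ℝ V') {F : V → V'} (hF : ContDiff ℝ ∞ F)
    (hiso : ∀ u x y, M'.form (fderiv ℝ F u x) (fderiv ℝ F u y) = M.form x y) (u v : V) :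
    fderiv ℝ F u = fderiv ℝ F v := by
  have hF1 : Differentiable ℝ F := hF.differentiable (by simp)
  have hD : Differentiable ℝ (fderiv ℝ F) :=
    (contDiff_infty_iff_fderiv.1 hF).2.differentiable (by simp)
  refine is_const_of_fderiv_eq_zero hD (fun u => ?_) u v
  set D2 := fderiv ℝ (fderiv ℝ F) u with hD2
  have hsurj : Function.Surjective (fderiv ℝ F u) :=
    (LinearMap.injective_iff_surjective_of_finrank_eq_finrank hn
      (f := (fderiv ℝ F u : V →ₗ[ℝ] V'))).1 (M.injective_of_isometry M' _ (hiso u))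
  have hsym : ∀ z x, D2 z x = D2 x z := fun z x =>
    second_derivative_symmetric (fun y => (hF1 y).hasFDerivAt) (hD u).hasFDerivAt z x
  have happ : ∀ x, HasFDerivAt (fun w => fderiv ℝ F w x) (D2.flip x) u := fun x => by
    have := (hD u).hasFDerivAt.clm_apply (hasFDerivAt_const x u)
    convert this using 1
    ext z
    simp [hD2]
  -- Differentiating the isometry condition makes `ℓ(D²F(z, x), DF y)` antisymmetric in `x, y`. It
  -- is symmetric in `z, x`, and these two symmetries together force it to vanish.
  have hanti : ∀ z x y, M'.form (D2 z x) (fderiv ℝ F u y) + M'.form (D2 z y) (fderiv ℝ F u x)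
      = 0 := by
    intro z x y
    have h1 := M'.formL.hasFDerivAt_of_bilinear (happ x) (happ y)
    have h2 : (fun w => M'.formL (fderiv ℝ F w x) (fderiv ℝ F w y)) = fun _ => M.form x y :=
      funext fun w => hiso w x y
    rw [h2] at h1
    have h3 := h1.unique (hasFDerivAt_const _ _)
    have h4 : M'.form (fderiv ℝ F u x) (D2 z y) + M'.form (D2 z x) (fderiv ℝ F u y) = 0 :=
      congrArg (fun L : V →L[ℝ] ℝ => L z) h3
    rw [M'.form_symm (D2 z y)]
    linarith
  ext z x
  refine M'.eq_zero_of_form_eq_zero fun w => ?_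
  obtain ⟨y, rfl⟩ := hsurj w
  have a1 := hanti z x y
  have a2 := hanti x y z
  have a3 := hanti y z x
  rw [hsym x z] at a2
  rw [hsym y x] at a3
  rw [hsym y z] at a3
  linarith

theorem IsLocalCausalIsometry.finrank_le {M : FlatSpacetime V} {M' : FlatSpacetime V'}
    {f : M.Point → M'.Point} (hf : IsLocalCausalIsometry M M' f) :
    Module.finrank ℝ V ≤ Module.finrank ℝ V' := by
  obtain ⟨U, g, -, h0, -, -, h⟩ := hf 0
  exact LinearMap.finrank_le_finrank_of_injective (f := (fderiv ℝ g 0 : V →ₗ[ℝ] V'))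
    (M.injective_of_isometry M' _ (h 0 h0).1)

theorem IsLocalCausalIsometry.lift {M : FlatSpacetime V} {M' : FlatSpacetime V'}
    {f : M.Point → M'.Point} (hf : IsLocalCausalIsometry M M' f) {F : V → V'}
    (hF : Continuous F) (hlift : ∀ v, M'.proj (F v) = f (M.proj v)) (v : V) :
    ContDiffAt ℝ ∞ F v ∧ (∀ x y, M'.form (fderiv ℝ F v x) (fderiv ℝ F v y) = M.form x y) ∧
      ∀ x ∈ M.cone, fderiv ℝ F v x ∈ M'.cone := by
  obtain ⟨U, g, hU, hv, hg, hfg, hd⟩ := hf v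
  obtain ⟨γ, hγ, hγv⟩ := M'.proj_eq_iff.1 ((hfg v hv).symm.trans (hlift v).symm)
  obtain ⟨r, hr, hball⟩ := Metric.isOpen_iff.1 hU v hv
  -- Both are lifts of `f ∘ proj` agreeing at `v`, so uniqueness of lifts transfers smoothness and
  -- the metric properties of `g` to `F`.
  have hEq : (Metric.ball v r).EqOn F (γ ∘ g) := by
    refine M'.isCoveringMap_proj.eqOn_of_comp_eqOn (convex_ball v r).isPreconnected
      hF.continuousOn ?_ (fun u hu => ?_) (Metric.mem_ball_self hr) hγv.symm
    · exact (contDiff_affineEquiv γ).continuous.comp_continuousOn (hg.continuousOn.mono hball)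
    · change M'.proj (F u) = M'.proj (γ (g u))
      rw [hlift, M'.proj_smul hγ, hfg u (hball hu)]
  have hev : F =ᶠ[𝓝 v] γ ∘ g := hEq.eventuallyEq_of_mem (Metric.ball_mem_nhds v hr)
  have hgv : ContDiffAt ℝ ∞ g v := hg.contDiffAt (hU.mem_nhds hv)
  have hder : fderiv ℝ F v
      = (LinearMap.toContinuousLinearMap (γ.linear : V' →ₗ[ℝ] V')).comp (fderiv ℝ g v) := by
    rw [hev.fderiv_eq]
    exact ((hasFDerivAt_affineEquiv γ (g v)).comp v
      (hgv.differentiableAt (by simp)).hasFDerivAt).fderiv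
  refine ⟨((contDiff_affineEquiv γ).contDiffAt.comp v hgv).congr_of_eventuallyEq hev, ?_, ?_⟩
  · intro x y
    rw [hder]
    exact (M'.form_linear γ hγ _ _).trans ((hd v hv).1 x y)
  · intro x hx
    rw [hder]
    exact M'.cone_linear γ hγ _ ((hd v hv).2 x hx)

theorem CausallyIsometric.exists_causalEquiv {M : FlatSpacetime V} {M' : FlatSpacetime V'}
    (h : M.CausallyIsometric M') : ∃ F : V ≃ᵃ[ℝ] V', IsCausalEquiv M M' F := by
  obtain ⟨f, hf, hf'⟩ := h
  have hn : Module.finrank ℝ V = Module.finrank ℝ V' := le_antisymm hf.finrank_le hf'.finrank_le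
  obtain ⟨e₀, he₀⟩ : ∃ e, M'.proj e = f (M.proj 0) := Quotient.exists_rep _
  -- The vector space `V` is simply connected, so the map to `M'` lifts globally.
  obtain ⟨F, ⟨-, hF⟩, -⟩ := M'.isCoveringMap_proj.existsUnique_continuousMap_lifts
    (⟨f ∘ M.proj, f.continuous.comp M.continuous_proj⟩ : C(V, M'.Point)) 0 e₀ he₀
  have hlift : ∀ v, M'.proj (F v) = f (M.proj v) := fun v => congrFun hF v
  have hloc := hf.lift F.continuous hlift
  have hconst := M.fderiv_eq_of_isometry M' hn
    (contDiff_iff_contDiffAt.2 fun v => (hloc v).1) (fun v => (hloc v).2.1)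
  have hinj := M.injective_of_isometry M' (fderiv ℝ F 0 : V →ₗ[ℝ] V') (hloc 0).2.1
  let L : V ≃ₗ[ℝ] V' := LinearEquiv.ofBijective (fderiv ℝ F 0 : V →ₗ[ℝ] V')
    ⟨hinj, (LinearMap.injective_iff_surjective_of_finrank_eq_finrank hn).1 hinj⟩
  let A : V ≃ᵃ[ℝ] V' := L.toAffineEquiv.trans (AffineEquiv.constVAdd ℝ V' (F 0))
  have hAF : ∀ v, F v = A v := by
    intro v
    have hdiff : Differentiable ℝ fun v => F v - fderiv ℝ F 0 v := fun v =>
      ((hloc v).1.differentiableAt (by simp)).sub (fderiv ℝ F 0).differentiableAt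
    have := is_const_of_fderiv_eq_zero hdiff (fun w => by
      rw [fderiv_fun_sub ((hloc w).1.differentiableAt (by simp)) (fderiv ℝ F 0).differentiableAt,
        ContinuousLinearMap.fderiv, hconst w 0, sub_self]) v 0
    simp only [map_zero, sub_zero] at this
    change F v = F 0 + fderiv ℝ F 0 v
    rw [← this, sub_add_cancel]
  -- `F ∘ γ` and `γ' ∘ F` lift the same map, so agreement at 0 suffices.
  have hconj : ∀ γ ∈ M.group, ∀ γ' ∈ M'.group, F (γ 0) = γ' (F 0) → ∀ v, A (γ v) = γ' (A v) := by
    intro γ hγ γ' hγ' h0 v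
    have := M'.isCoveringMap_proj.eq_of_comp_eq (g₁ := fun v => F (γ v)) (g₂ := fun v => γ' (F v))
      (F.continuous.comp (contDiff_affineEquiv γ).continuous)
      ((contDiff_affineEquiv γ').continuous.comp F.continuous)
      (funext fun v => by
        change M'.proj (F (γ v)) = M'.proj (γ' (F v))
        rw [M'.proj_smul hγ', hlift, hlift, M.proj_smul hγ]) 0 h0
    rw [← hAF, ← hAF]
    exact congrFun this v
  refine ⟨A, (hloc 0).2.1, (hloc 0).2.2, fun γ hγ => ?_, fun γ' hγ' => ?_⟩
  · obtain ⟨γ', hγ', e⟩ := M'.proj_eq_iff.1 (show M'.proj (F 0) = M'.proj (F (γ 0)) by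
      rw [hlift, hlift, M.proj_smul hγ])
    exact ⟨γ', hγ', hconj γ hγ γ' hγ' e.symm⟩
  · have hw : F (A.symm (γ' (F 0))) = γ' (F 0) := by rw [hAF, A.apply_symm_apply]
    obtain ⟨γ, hγ, e⟩ := M.proj_eq_iff.1 (show M.proj 0 = M.proj (A.symm (γ' (F 0))) by
      apply f.injective
      rw [← hlift, ← hlift, hw, M'.proj_smul hγ'])
    exact ⟨γ, hγ, hconj γ hγ γ' hγ' (by rw [e, hw])⟩

end FlatSpacetime

end

/-! ### The classification theorem -/

theorem theorem2 {V V' : Type*}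
    [NormedAddCommGroup V] [NormedSpace ℝ V] [FiniteDimensional ℝ V]
    [NormedAddCommGroup V'] [NormedSpace ℝ V'] [FiniteDimensional ℝ V']
    (M : FlatSpacetime V) (M' : FlatSpacetime V')
    (hM : M.IsStrictlyCausal) (hMu : M.IsUnipotent)
    (hM' : M'.IsStrictlyCausal) (hMu' : M'.IsUnipotent) :
    Nonempty M.Realization ∧ Nonempty M'.Realization ∧
    ∀ (D : M.Realization) (D' : M'.Realization),
      (M.CausallyIsometric M' ↔
        D.signature = D'.signature ∧
        ∃ (h : D.m = D'.m) (X : Matrix.GeneralLinearGroup (Fin D.m) ℤ) (α β : ℝ), 0 < α ∧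
          ∀ s : ℝ, D.charPoly s =
            ((X : Matrix (Fin D.m) (Fin D.m) ℤ).map (Int.cast : ℤ → ℝ))ᵀ *
              (D'.charPoly (α * s + β)).submatrix (Fin.cast h) (Fin.cast h) *
              (X : Matrix (Fin D.m) (Fin D.m) ℤ).map (Int.cast : ℤ → ℝ)) := by
  refine ⟨hM.nonempty_realization hMu, hM'.nonempty_realization hMu', fun D D' => ⟨fun h => ?_, ?_⟩⟩
  · obtain ⟨F, hF⟩ := h.exists_causalEquiv
    obtain ⟨E, α, β, hE⟩ := D.exists_isEquivalence_of_causalEquiv D' hF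
    obtain ⟨hm, X, hX⟩ := hE.exists_matrix
    exact ⟨hE.signature_eq F.linear.finrank_eq, hm, X, α, β, hE.pos, hX⟩
  · rintro ⟨hsig, hm, X, α, β, hα, hX⟩
    obtain ⟨E, hE⟩ := D.exists_isEquivalence_of_charPoly D' hm X hα hX
    obtain ⟨F, hF⟩ := hE.exists_causalEquiv (congrArg Prod.fst hsig)
    exact hF.causallyIsometric
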